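/- **Setting.** Let $M>0$, $H\in\mathbb R$. The Kruskal extension of the Schwarzschild spacetime of mass $M$ is $\{(U,V)\in\mathbb R^2: UV>-2M\}\times S^2$ with the metric $$\mathrm ds^2=\frac{16M^2e^{-r/2M}}{r}\,\mathrm dU\,\mathrm dV+r^2(\mathrm d\theta^2+\sin^2\theta\,\mathrm d\phi^2),$$ where $r=r(U,V)>0$ is determined by $(r-2M)e^{r/2M}=UV$. It is time-oriented by $\partial_T=\partial_V-\partial_U$, where $U=X-T$, $V=X+T$. Region II is $\{U<0<V\}$; there $t=2M\ln|V/U|$, and the point with coordinates $(t,r)$, $0<r<2M$, is $$U=-e^{-\frac1{4M}(t-r-2M\ln|r-2M|)},\qquad V=e^{\frac1{4M}(t+r+2M\ln|r-2M|)}.$$ Spherically symmetric hypersurfaces are identified with curves in the $(U,V)$-plane. The mean curvature of a spacelike hypersurface is $\frac13$ of the trace of its second fundamental form $K(X,Y)=g(\nabla_XN,Y)$, with $N$ the future directed unit normal. On $(0,2M)$ let $h(r)=1-\frac{2M}r$ and $k_H(r)=-Hr^3-r^{3/2}(2M-r)^{1/2}$. Let $c_H$ be the minimum of $k_H$, attained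 at $r_H\in(0,2M)$. For $c_H<c<0$ let $R_c=r^-_{H,c}$ be the solution of $k_H(r)=c$ in $(0,r_H)$, and for $0\le r\le R_c$ put $$f(r;H,c)=\int_{R_c}^{r}\frac1{h(x)}\sqrt{\frac{l(x)^2}{l(x)^2-1}}\,\mathrm dx,\qquad l(x)=\frac1{\sqrt{-h(x)}}\Bigl(-Hx-\frac c{x^2}\Bigr).$$ Let $\Sigma^-_{H,c}$ be the union of the two graphs $t=\pm f(r;H,c)$, $0<r\le R_c$, in region II, and write $V(0;c)=e^{\frac1{4M}(f(0;H,c)+2M\ln 2M)}$. **Theorem.** For all $M>0$ and $H\in\mathbb R$: 1. For every $c\in(c_H,0)$, $\Sigma^-_{H,c}$ is a smooth connected spacelike spherically symmetric hypersurface of constant mean curvature $H$, and it is $T$-axisymmetric, that is, invariant under $(U,V)\mapsto(-V,-U)$. 2. The family $\{\Sigma^-_{H,c}\}_{c_H<c<0}$ is a smooth foliation of the part $\{0<r<r_H\}$ of region II: this set is open, the hypersurfaces are pairwise disjoint, their union is this set, and around each of its points there is a smooth chart in which they are the level sets of one coordinate. 3. For every $c\in(c_H,0)$ the integral defining $f(0;H,c)$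 converges (absolutely), and $c\mapsto\ln V(0;c)$ is differentiable on $(c_H,0)$ with $\frac{\mathrm d\ln V(0;c)}{\mathrm dc}\le0$. 4. $f(0;H,c)\to\infty$ as $c\to c_H^+$, and $f(0;H,c)\to0$ as $c\to0^-$. 5. As $c\to c_H^+$ the hypersurfaces converge pointwise to the cylindrical hypersurface $r=r_H$: for every $t\in\mathbb R$ and all $c>c_H$ close enough to $c_H$ (depending on $t$), $\Sigma^-_{H,c}$ contains exactly one point of region II with time coordinate $t$, and its $r$-coordinate tends to $r_H$ as $c\to c_H^+$. -/

import Mathlib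

open Set Filter Topology
open scoped ContDiff

noncomputable section

namespace Kruskal

/-! ### Hypersurfaces in a coordinate chart of a Lorentzian manifold -/

/-- The partial derivative `∂F/∂xᵢ` at `x`. -/
def partialDeriv {n : ℕ} (i : Fin n) (F : (Fin n → ℝ) → ℝ) (x : Fin n → ℝ) : ℝ :=
  deriv (fun s : ℝ => F (Function.update x i s)) (x i)

/-- The Christoffel symbol `Γᵏᵢⱼ` of the metric `g`. -/
def christoffel {n : ℕ} (g : (Fin n → ℝ) → Matrix (Fin n) (Fin n) ℝ)
    (k i j : Fin n) (x : Fin n → ℝ) : ℝ :=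
  (1 / 2) * ∑ l, (g x)⁻¹ k l *
    (partialDeriv i (fun y => g y j l) x + partialDeriv j (fun y => g y i l) x
      - partialDeriv l (fun y => g y i j) x)

/-- The scalar product `g(v, w)` of two vectors. -/
def scalar {n : ℕ} (g : Matrix (Fin n) (Fin n) ℝ) (v w : Fin n → ℝ) : ℝ :=
  ∑ i, ∑ j, g i j * v i * w j

/-- The coordinate tangent vector `∂ₐΦ` of the parametrized hypersurface `Φ`. -/
def tangent {m n : ℕ} (Φ : (Fin m → ℝ) → (Fin n → ℝ)) (a : Fin m) (y : Fin m → ℝ) :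
    Fin n → ℝ :=
  fun k => partialDeriv a (fun z => Φ z k) y

/-- The first fundamental form (induced metric) of `Φ`. -/
def firstForm {m n : ℕ} (g : (Fin n → ℝ) → Matrix (Fin n) (Fin n) ℝ)
    (Φ : (Fin m → ℝ) → (Fin n → ℝ)) (y : Fin m → ℝ) : Matrix (Fin m) (Fin m) ℝ :=
  Matrix.of fun a b => scalar (g (Φ y)) (tangent Φ a y) (tangent Φ b y)

/-- The ambient covariant derivative `∇_{∂ₐΦ} ∂_bΦ` (Levi-Civita connection). -/
def covTangent {m n : ℕ} (g : (Fin n → ℝ) → Matrix (Fin n) (Fin n) ℝ)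
    (Φ : (Fin m → ℝ) → (Fin n → ℝ)) (a b : Fin m) (y : Fin m → ℝ) : Fin n → ℝ :=
  fun k => partialDeriv a (fun z => tangent Φ b z k) y
    + ∑ i, ∑ j, christoffel g k i j (Φ y) * tangent Φ a y i * tangent Φ b y j

/-- The second fundamental form `K(∂ₐ, ∂_b) = g(∇ₐN, ∂_b) = -g(N, ∇ₐ∂_b)` with respect to the
normal vector `N`. -/
def secondForm {m n : ℕ} (g : (Fin n → ℝ) → Matrix (Fin n) (Fin n) ℝ)
    (Φ : (Fin m → ℝ) → (Fin n → ℝ)) (N : Fin n → ℝ) (y : Fin m → ℝ) :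
    Matrix (Fin m) (Fin m) ℝ :=
  Matrix.of fun a b => -scalar (g (Φ y)) N (covTangent g Φ a b y)

/-- The hypersurface `Φ` is spacelike at the parameter `y`, and its mean curvature there, the
average `(1/m) tr K` of the principal curvatures with respect to the future directed timelike
unit normal, equals `H`. The vector `τ` fixes the time orientation. -/
def IsSpacelikeWithMeanCurvature {m n : ℕ} (g : (Fin n → ℝ) → Matrix (Fin n) (Fin n) ℝ)
    (τ : Fin n → ℝ) (Φ : (Fin m → ℝ) → (Fin n → ℝ)) (y : Fin m → ℝ) (H : ℝ) : Prop :=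
  (firstForm g Φ y).PosDef ∧
    ∃ N : Fin n → ℝ, (∀ a, scalar (g (Φ y)) N (tangent Φ a y) = 0) ∧
      scalar (g (Φ y)) N N = -1 ∧ scalar (g (Φ y)) N τ < 0 ∧
      (1 / (m : ℝ)) * ((firstForm g Φ y)⁻¹ * secondForm g Φ N y).trace = H

/-! ### The Kruskal extension of the Schwarzschild spacetime of mass `M` -/

/-- The area radius as a function of `w = UV`: the `r > 0` with `(r - 2M) exp(r / 2M) = w`,
which exists and is unique for `w > -2M`. -/
def areaRadius (M w : ℝ) : ℝ :=
  Function.invFunOn (fun r => (r - 2 * M) * Real.exp (r / (2 * M))) (Ioi 0) w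

/-- The Kruskal plane in the null coordinates `(U, V) = (X - T, X + T)`. Each of its points
stands for a round two-sphere of radius `areaRadius M (U * V)`. -/
def plane (M : ℝ) : Set (ℝ × ℝ) := {p | -2 * M < p.1 * p.2}

/-- Region II (the black hole): `T > |X|`. -/
def regionII (M : ℝ) : Set (ℝ × ℝ) := {p ∈ plane M | p.1 < 0 ∧ 0 < p.2}

/-- The Kruskal metric `(16 M² exp(-r / 2M) / r) dU dV + r² dθ² + r² sin² θ dφ²` in the
coordinates `(U, V, θ, φ)`. -/
def metric (M : ℝ) (x : Fin 4 → ℝ) : Matrix (Fin 4) (Fin 4) ℝ :=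
  let r := areaRadius M (x 0 * x 1)
  let e := 8 * M ^ 2 * Real.exp (-r / (2 * M)) / r
  !![0, e, 0, 0;
     e, 0, 0, 0;
     0, 0, r ^ 2, 0;
     0, 0, 0, r ^ 2 * Real.sin (x 2) ^ 2]

/-- The vector `∂_T = -∂_U + ∂_V`, which fixes the time orientation. -/
def dT : Fin 4 → ℝ := ![-1, 1, 0, 0]

/-- The spherically symmetric hypersurface generated by the curve `γ` in the Kruskal plane,
parametrized by `(s, θ, φ)`. -/
def rotate (γ : ℝ → ℝ × ℝ) (y : Fin 3 → ℝ) : Fin 4 → ℝ :=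
  ![(γ (y 0)).1, (γ (y 0)).2, y 1, y 2]

/-- `S` is (the profile in the Kruskal plane of) a smooth connected spacelike spherically
symmetric hypersurface with constant mean curvature `H`. Spacelike curves have strictly monotone
`U`, so that the parametrization `γ` is automatically an embedding. -/
def IsSSCMC (M H : ℝ) (S : Set (ℝ × ℝ)) : Prop :=
  S ⊆ plane M ∧
    ∃ (a b : ℝ) (γ : ℝ → ℝ × ℝ), a < b ∧ ContDiffOn ℝ ∞ γ (Ioo a b) ∧ γ '' Ioo a b = S ∧
      ∀ s ∈ Ioo a b, ∀ θ ∈ Ioo 0 Real.pi, ∀ φ : ℝ,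
        IsSpacelikeWithMeanCurvature (metric M) dT (rotate γ) ![s, θ, φ] H

/-- An SS-CMC hypersurface that is symmetric with respect to the `T`-axis `U + V = 0`. -/
def IsTSSCMC (M H : ℝ) (S : Set (ℝ × ℝ)) : Prop :=
  IsSSCMC M H S ∧ ∀ p ∈ S, ((-p.2, -p.1) : ℝ × ℝ) ∈ S

/-! ### The family `Σ⁻_{H,c}`, `c_H < c < 0` -/

/-- `h(r) = 1 - 2M/r`. -/
def h (M r : ℝ) : ℝ := 1 - 2 * M / r

/-- `k_H(r) = -H r³ - r^{3/2} (2M - r)^{1/2}`, for `0 < r < 2M`. -/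
def k (M H r : ℝ) : ℝ := -H * r ^ 3 - r ^ (3 / 2 : ℝ) * (2 * M - r) ^ (1 / 2 : ℝ)

/-- `c_H`, the minimum of `k_H` on `(0, 2M)`. -/
def cMin (M H : ℝ) : ℝ := sInf (k M H '' Ioo 0 (2 * M))

/-- `r_H`, the point of `(0, 2M)` at which `k_H` takes its minimum. -/
def rMin (M H : ℝ) : ℝ := Function.invFunOn (k M H) (Ioo 0 (2 * M)) (cMin M H)

/-- `r⁻_{H,c}`, the solution of `k_H(r) = c` on the interval `(0, r_H)`, where `k_H` decreases. -/
def rMinus (M H c : ℝ) : ℝ := Function.invFunOn (k M H) (Ioo 0 (rMin M H)) c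

/-- `l(r; H, c) = (-h(r))^{-1/2} (-H r - c / r²)`, for `0 < r < 2M`. -/
def l (M H c r : ℝ) : ℝ := (1 / √(-h M r)) * (-H * r - c / r ^ 2)

/-- The slope `dt/dr = (1/h) (l² / (l² - 1))^{1/2}` of the half `t ≥ 0` of `Σ⁻_{H,c}`. -/
def slope (M H c r : ℝ) : ℝ := (1 / h M r) * √(l M H c r ^ 2 / (l M H c r ^ 2 - 1))

/-- The height function `f(r; H, c)` of the half `t ≥ 0` of `Σ⁻_{H,c}`, for `0 ≤ r ≤ r⁻_{H,c}`. -/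
def height (M H c r : ℝ) : ℝ := ∫ x in (rMinus M H c)..r, slope M H c x

/-- The coordinate `U` of the point of region II with Schwarzschild coordinates `(t, r)`. -/
def coordU (M t r : ℝ) : ℝ := -Real.exp (-(t - (r + 2 * M * Real.log |r - 2 * M|)) / (4 * M))

/-- The coordinate `V` of the point of region II with Schwarzschild coordinates `(t, r)`. -/
def coordV (M t r : ℝ) : ℝ := Real.exp ((t + (r + 2 * M * Real.log |r - 2 * M|)) / (4 * M))

/-- The hypersurface `Σ⁻_{H,c}` in the Kruskal plane: the union of the graphs `t = f(r)` and
`t = -f(r)` over `0 < r ≤ r⁻_{H,c}`. -/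
def leaf (M H c : ℝ) : Set (ℝ × ℝ) :=
  {p | ∃ r ∈ Ioc 0 (rMinus M H c), ∃ t : ℝ, (t = height M H c r ∨ t = -height M H c r) ∧
    p = (coordU M t r, coordV M t r)}

/-- The part of region II between the hypersurfaces `r = 0` and `r = r_H`. -/
def innerRegion (M H : ℝ) : Set (ℝ × ℝ) :=
  {p ∈ regionII M | areaRadius M (p.1 * p.2) < rMin M H}

/-- The sets `L c`, `c ∈ I`, are the leaves of a smooth codimension one foliation of the open set
`W` of the plane: they are pairwise disjoint, they cover `W`, and every point of `W` has a
smooth chart around it in which the leaves are the level sets of the first coordinate. -/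
structure IsFoliation (W : Set (ℝ × ℝ)) (I : Set ℝ) (L : ℝ → Set (ℝ × ℝ)) : Prop where
  isOpen : IsOpen W
  disjoint : I.PairwiseDisjoint L
  cover : ⋃ c ∈ I, L c = W
  chart : ∀ p ∈ W, ∃ e : OpenPartialHomeomorph (ℝ × ℝ) (ℝ × ℝ),
    p ∈ e.source ∧ e.source ⊆ W ∧
    ContDiffOn ℝ ∞ e e.source ∧ ContDiffOn ℝ ∞ e.symm e.target ∧
    ∀ q ∈ e.source, ∀ q' ∈ e.source, (∃ c ∈ I, q ∈ L c ∧ q' ∈ L c) ↔ (e q).1 = (e q').1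

end Kruskal

end

/-!
The half `t ≥ 0` of `Σ⁻_{H,c}` satisfies `dt/dr = -r L / ((2M - r) √D)` with `L(r) = -H r³ - c`
and the polynomial `D = L² - r³ (2M - r)`, which has a root at the turning point `R = r⁻_{H,c}`,
where `c = k_H(R)`. Everything is expressed through the two parameters `R ∈ (0, r_H)`, which
numbers the leaves, and `σ ∈ (-1, 1)`, which runs along a leaf by `r = R (1 - σ²)`.

*Smoothness.* Since `R` is a root of `D`, the quotient `D(R y) / (R³ (1 - y))` is a polynomial in
`y` (`discQuot`, `disc_mul`), positive for `y ≤ 1`: at `y = 1` it is a positive multiple of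
`-k_H'(R)`, and this is where `R < r_H` enters (`discQuot_one`, `discQuot_pos`). Hence `dt/dσ` is
smooth and even in `σ`, its primitive `time` is smooth in `(R, σ)` and odd in `σ`, and the leaf is
the image of `σ ↦ param (R, σ)` (`contDiffOn_parametric_primitive`, `leaf_eq_image`). The same
substitution shows that the integral defining the height function converges absolutely.

*Mean curvature.* For a curve `(U(s), V(s))` with `U', V' > 0` the generated hypersurface is
spacelike, and its mean curvature is computed from the Christoffel symbols in
`isSpacelikeWithMeanCurvature_rotate`. With `Y² = D(r)` a leaf solves the regular system
`r' = μ Y`, `Y' = μ D'(r) / 2`, `t' = μ r L / (2M - r)` with a positive factor `μ`, also at the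
turning point, and the mean curvature equation becomes the identity `meanCurvature_identity`.

*Monotonicity.* The heart of the matter is that at fixed `r` the time `t ≥ 0` of the leaf increases
with `R`. Differentiating `dt/dr` in `c` gives `-r⁴ D^{-3/2}`, which is not integrable at the
turning point. With `p = (r D' - 4 D) / 2`, which is negative on `[0, R]` (`discAux_neg`), the
function `β = r⁵ / (p √D)` satisfies `β' ≤ -r⁴ D^{-3/2}` (`exists_hasDerivAt_beta`) and has the same
singularity. So the difference of `(∂t/∂R)_r` and `k_H'(R) β` is monotone along the leaf; it tends
to `0` at the turning point, because apart from a summand that vanishes there it is the quotient by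
`σ` of an even smooth function of `σ` with the value `0` at `0` (`tendsto_fixedRadiusDeriv_sub`).
Therefore `(∂t/∂R)_r ≥ k_H'(R) β`, which is positive for `r > 0` and vanishes at `r = 0`
(`mul_beta_le_fixedRadiusDeriv`). The value at `r = 0` gives the sign of the derivative of
`ln V(0; c)`. For `r > 0` the inequality says that the leaves are disjoint (`strictMonoOn_time`) and
that `(R, σ) ↦ (U, V)` has no critical point (`jacobian_pos`), so that its local inverses are the
charts of the foliation.

*Limits.* At `R = r_H` the root of `D` is double (`discQuot_rMin_le`), so that `|dt/dr|` is bounded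
below by a multiple of `1 / (r_H - r)` uniformly in the leaf, and `t` at fixed `r` grows beyond all
bounds as `R → r_H` (`tendsto_time_rMin`). This yields the divergence of `f(0; H, c)`, that the
leaves cover all of `{0 < r < r_H}`, and the convergence to the cylinder `r = r_H`. As `c → 0⁻`,
the function `dt/dσ` is still continuous at `R = 0`, where it vanishes.
-/

namespace Kruskal

/-! ### Primitives depending on a parameter -/

theorem continuousOn_parametric_primitive {S : Set ℝ} {G : ℝ × ℝ → ℝ}
    (hG : ContinuousOn G (S ×ˢ univ)) :
    ContinuousOn (fun p : ℝ × ℝ => ∫ x in (0 : ℝ)..p.2, G (p.1, x)) (S ×ˢ univ) := by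
  have h1 : Continuous (Function.uncurry fun (a : S) (x : ℝ) => G (a, x)) := by
    have h2 : Continuous fun p : S × ℝ => ((p.1 : ℝ), p.2) := by fun_prop
    exact hG.comp_continuous h2 fun p => ⟨p.1.2, mem_univ _⟩
  have h3 := intervalIntegral.continuous_parametric_primitive_of_continuous
    (μ := MeasureTheory.volume) (a₀ := 0) h1
  rw [continuousOn_iff_continuous_domRestrict]
  have h4 : Continuous fun p : (S ×ˢ univ : Set (ℝ × ℝ)) =>
      ((⟨p.1.1, p.2.1⟩ : S), p.1.2) := by fun_prop
  exact h3.comp h4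

theorem continuous_slice {S : Set ℝ} {G : ℝ × ℝ → ℝ}
    (hG : ContinuousOn G (S ×ˢ univ)) {a : ℝ} (ha : a ∈ S) : Continuous fun x => G (a, x) :=
  hG.comp_continuous (by fun_prop) fun _ => ⟨ha, mem_univ _⟩

theorem hasDerivAt_parametric_primitive_right {S : Set ℝ} {G : ℝ × ℝ → ℝ}
    (hG : ContinuousOn G (S ×ˢ univ)) {a : ℝ} (ha : a ∈ S) (s : ℝ) :
    HasDerivAt (fun s => ∫ x in (0 : ℝ)..s, G (a, x)) (G (a, s)) s :=
  ((continuous_slice hG ha).integral_hasStrictDerivAt 0 s).hasDerivAt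

/-- Differentiation of `∫₀ˢ G(a, x) dx` with respect to the parameter `a`. -/
theorem hasDerivAt_parametric_primitive_left {S : Set ℝ} (hS : IsOpen S) {G : ℝ × ℝ → ℝ}
    (hG : ContDiffOn ℝ 1 G (S ×ˢ univ)) {a : ℝ} (ha : a ∈ S) (s : ℝ) :
    HasDerivAt (fun a => ∫ x in (0 : ℝ)..s, G (a, x))
      (∫ x in (0 : ℝ)..s, fderiv ℝ G (a, x) (1, 0)) a := by
  have hO : IsOpen (S ×ˢ (univ : Set ℝ)) := hS.prod isOpen_univ
  have hG' : ContinuousOn (fun p => fderiv ℝ G p (1, 0)) (S ×ˢ univ) :=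
    (hG.continuousOn_fderiv_of_isOpen hO le_rfl).clm_apply continuousOn_const
  obtain ⟨ε, hε, hb⟩ := Metric.nhds_basis_closedBall.mem_iff.1 (hS.mem_nhds ha)
  have hK : IsCompact (Metric.closedBall a ε ×ˢ uIcc 0 s) :=
    (isCompact_closedBall a ε).prod isCompact_uIcc
  obtain ⟨C, hC⟩ := hK.exists_bound_of_continuousOn
    (hG'.mono (prod_mono hb (subset_univ _)))
  refine (intervalIntegral.hasDerivAt_integral_of_dominated_loc_of_deriv_le
    (μ := MeasureTheory.volume) (F := fun a x => G (a, x))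
    (F' := fun a x => fderiv ℝ G (a, x) (1, 0)) (bound := fun _ => C)
    (Metric.closedBall_mem_nhds a hε) ?_ ?_ ?_ ?_ ?_ ?_).2
  · filter_upwards [hS.mem_nhds ha] with b hb
    exact (continuous_slice hG.continuousOn hb).aestronglyMeasurable
  · exact (continuous_slice hG.continuousOn ha).intervalIntegrable _ _
  · exact (continuous_slice hG' ha).aestronglyMeasurable
  · exact .of_forall fun t ht x hx => hC (x, t) ⟨hx, uIoc_subset_uIcc ht⟩
  · exact intervalIntegrable_const
  · refine .of_forall fun t _ x hx => ?_
    have h1 : HasFDerivAt G (fderiv ℝ G (x, t)) (x, t) :=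
      ((hG.differentiableOn one_ne_zero).differentiableAt
        (hO.mem_nhds ⟨hb hx, mem_univ _⟩)).hasFDerivAt
    have h2 : HasDerivAt (fun y : ℝ => (y, t)) ((1 : ℝ), (0 : ℝ)) x :=
      (hasDerivAt_id x).prodMk (hasDerivAt_const x t)
    exact h1.comp_hasDerivAt x h2

theorem hasFDerivAt_parametric_primitive {S : Set ℝ} (hS : IsOpen S) {G : ℝ × ℝ → ℝ}
    (hG : ContDiffOn ℝ 1 G (S ×ˢ univ)) {p : ℝ × ℝ} (hp : p ∈ S ×ˢ (univ : Set ℝ)) :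
    HasFDerivAt (fun p : ℝ × ℝ => ∫ x in (0 : ℝ)..p.2, G (p.1, x))
      ((∫ x in (0 : ℝ)..p.2, fderiv ℝ G (p.1, x) (1, 0)) • ContinuousLinearMap.fst ℝ ℝ ℝ +
        G p • ContinuousLinearMap.snd ℝ ℝ ℝ) p := by
  have hO : IsOpen (S ×ˢ (univ : Set ℝ)) := hS.prod isOpen_univ
  have hG' : ContinuousOn (fun p => fderiv ℝ G p (1, 0)) (S ×ˢ univ) :=
    (hG.continuousOn_fderiv_of_isOpen hO le_rfl).clm_apply continuousOn_const
  have hcont := continuousOn_parametric_primitive hG'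
  have key := hasStrictFDerivAt_uncurry_coprod (𝕜 := ℝ) (u := p)
    (f := fun a s => ∫ x in (0 : ℝ)..s, G (a, x))
    (f₁ := fun a s => (∫ x in (0 : ℝ)..s, fderiv ℝ G (a, x) (1, 0)) •
      ContinuousLinearMap.id ℝ ℝ)
    (f₂ := fun a s => G (a, s) • ContinuousLinearMap.id ℝ ℝ) ?_ ?_ ?_ ?_
  · refine key.hasFDerivAt.congr_fderiv ?_
    ext <;> simp [Function.HasUncurry.uncurry]
  · filter_upwards [hO.mem_nhds hp] with v hv
    refine (hasDerivAt_parametric_primitive_left hS hG hv.1 v.2).hasFDerivAt.congr_fderiv ?_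
    ext; simp [Function.HasUncurry.uncurry]
  · filter_upwards [hO.mem_nhds hp] with v hv
    refine (hasDerivAt_parametric_primitive_right hG.continuousOn hv.1
      v.2).hasFDerivAt.congr_fderiv ?_
    ext; simp [Function.HasUncurry.uncurry]
  · exact (hcont.continuousAt (hO.mem_nhds hp)).smul continuousAt_const
  · exact (hG.continuousOn.continuousAt (hO.mem_nhds hp)).smul continuousAt_const

/-- A primitive of a smooth function that depends on a parameter is jointly smooth. -/
theorem contDiffOn_parametric_primitive {S : Set ℝ} (hS : IsOpen S) {G : ℝ × ℝ → ℝ}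
    (hG : ContDiffOn ℝ ∞ G (S ×ˢ univ)) :
    ContDiffOn ℝ ∞ (fun p : ℝ × ℝ => ∫ x in (0 : ℝ)..p.2, G (p.1, x)) (S ×ˢ univ) := by
  have hO : IsOpen (S ×ˢ (univ : Set ℝ)) := hS.prod isOpen_univ
  rw [contDiffOn_infty]
  intro n
  induction n generalizing G with
  | zero =>
    simpa using continuousOn_parametric_primitive hG.continuousOn
  | succ n ih =>
    have h1 : ContDiffOn ℝ 1 G (S ×ˢ univ) := hG.of_le (by norm_cast)
    have h2 : ContDiffOn ℝ ∞ (fun p => fderiv ℝ G p (1, 0)) (S ×ˢ univ) :=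
      (hG.fderiv_of_isOpen hO (m := ∞) (by simp)).clm_apply contDiffOn_const
    push_cast
    rw [contDiffOn_succ_iff_fderiv_of_isOpen hO]
    refine ⟨fun p hp => (hasFDerivAt_parametric_primitive hS h1
      hp).differentiableAt.differentiableWithinAt, by simp, ?_⟩
    have h3 : ContDiffOn ℝ n (fun p : ℝ × ℝ =>
        (∫ x in (0 : ℝ)..p.2, fderiv ℝ G (p.1, x) (1, 0)) • ContinuousLinearMap.fst ℝ ℝ ℝ +
        G p • ContinuousLinearMap.snd ℝ ℝ ℝ) (S ×ˢ univ) :=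
      ((ih h2).smul contDiffOn_const).add
        ((hG.of_le (by exact_mod_cast le_top)).smul contDiffOn_const)
    exact h3.congr fun p hp => (hasFDerivAt_parametric_primitive hS h1 hp).fderiv

/-! ### The function `k_H` and its minimum -/

/-- The function `q(r) = r^{3/2} (2M - r)^{1/2}`, so that `k_H(r) = -H r³ - q(r)`. -/
noncomputable def qFun (M r : ℝ) : ℝ := r * √r * √(2 * M - r)

/-- The function `Q(r) = 3 H q(r) + 3M - 2r`, which up to a negative factor is `k_H'`. -/
noncomputable def crit (M H r : ℝ) : ℝ := 3 * H * qFun M r + 3 * M - 2 * r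

theorem continuous_qFun (M : ℝ) : Continuous (qFun M) := by unfold qFun; fun_prop

theorem continuous_crit (M H : ℝ) : Continuous (crit M H) := by
  have := continuous_qFun M
  unfold crit; fun_prop

theorem qFun_nonneg {M r : ℝ} (hr : 0 ≤ r) : 0 ≤ qFun M r := by unfold qFun; positivity

theorem qFun_pos {M r : ℝ} (hr : r ∈ Ioo 0 (2 * M)) : 0 < qFun M r := by
  have h1 : 0 < r := hr.1
  have h2 : 0 < 2 * M - r := sub_pos.2 hr.2
  unfold qFun; positivity

theorem qFun_sq {M r : ℝ} (h0 : 0 ≤ r) (h1 : r ≤ 2 * M) :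
    qFun M r ^ 2 = r ^ 3 * (2 * M - r) := by
  unfold qFun
  rw [mul_pow, mul_pow, Real.sq_sqrt h0, Real.sq_sqrt (by linarith)]; ring

theorem qFun_eq_sqrt {M r : ℝ} (h0 : 0 ≤ r) (h1 : r ≤ 2 * M) :
    qFun M r = √(r ^ 3 * (2 * M - r)) := by
  rw [← qFun_sq h0 h1, Real.sqrt_sq (qFun_nonneg h0)]

theorem k_eq {M r : ℝ} (H : ℝ) (h0 : 0 ≤ r) : k M H r = -H * r ^ 3 - qFun M r := by
  have h1 : r ^ (3 / 2 : ℝ) = r * √r := by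
    rw [show (3 / 2 : ℝ) = 1 + 1 / 2 by norm_num,
      Real.rpow_add_of_nonneg h0 (by norm_num) (by norm_num), Real.rpow_one, Real.sqrt_eq_rpow]
  rw [k, qFun, h1, Real.sqrt_eq_rpow (2 * M - r)]

theorem k_zero {M : ℝ} (H : ℝ) : k M H 0 = 0 := by
  rw [k_eq H le_rfl]; simp [qFun]

theorem hasDerivAt_qFun {M r : ℝ} (hr : r ∈ Ioo 0 (2 * M)) :
    HasDerivAt (qFun M) (r ^ 2 * (3 * M - 2 * r) / qFun M r) r := by
  have h0 := hr.1
  have h1 : 0 < 2 * M - r := sub_pos.2 hr.2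
  have h2 : HasDerivAt (fun r : ℝ => r ^ 3 * (2 * M - r))
      (3 * r ^ 2 * (2 * M - r) + r ^ 3 * (-1)) r := by
    simpa using (hasDerivAt_pow 3 r).fun_mul ((hasDerivAt_id r).const_sub (2 * M))
  have h3 := h2.sqrt (by positivity)
  rw [← qFun_eq_sqrt h0.le hr.2.le] at h3
  refine (h3.congr_deriv ?_).congr_of_eventuallyEq ?_
  · have := qFun_pos hr
    field_simp; ring
  · filter_upwards [isOpen_Ioo.mem_nhds hr] with x hx using qFun_eq_sqrt hx.1.le hx.2.le

theorem hasDerivAt_k {M : ℝ} (H : ℝ) {r : ℝ} (hr : r ∈ Ioo 0 (2 * M)) :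
    HasDerivAt (k M H) (-(r ^ 2 / qFun M r) * crit M H r) r := by
  have h1 : HasDerivAt (fun r => -H * r ^ 3 - qFun M r)
      (-H * (3 * r ^ 2) - r ^ 2 * (3 * M - 2 * r) / qFun M r) r := by
    simpa using ((hasDerivAt_pow 3 r).const_mul (-H)).fun_sub (hasDerivAt_qFun hr)
  refine (h1.congr_deriv ?_).congr_of_eventuallyEq ?_
  · have := qFun_pos hr
    unfold crit; field_simp; ring
  · filter_upwards [isOpen_Ioo.mem_nhds hr] with x hx using k_eq H hx.1.le

theorem continuousOn_k (M H : ℝ) : ContinuousOn (k M H) (Icc 0 (2 * M)) := by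
  have h1 : Continuous fun r => -H * r ^ 3 - qFun M r := by
    have := continuous_qFun M
    fun_prop
  exact h1.continuousOn.congr fun r hr => k_eq H hr.1

/-- The quotient `Q / q = 3H + (3M - 2r) / q(r)` decreases, so that `k_H'` changes sign once. -/
theorem strictAntiOn_div_qFun (M : ℝ) :
    StrictAntiOn (fun r => (3 * M - 2 * r) / qFun M r) (Ioo 0 (2 * M)) := by
  have key : ∀ r ∈ Ioo 0 (2 * M), HasDerivAt (fun r => (3 * M - 2 * r) / qFun M r)
      (((-2) * qFun M r - (3 * M - 2 * r) * (r ^ 2 * (3 * M - 2 * r) / qFun M r)) /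
        qFun M r ^ 2) r := fun r hr => by
    have h1 : HasDerivAt (fun r : ℝ => 3 * M - 2 * r) (-2) r := by
      simpa using ((hasDerivAt_id r).const_mul 2).const_sub (3 * M)
    exact h1.div (hasDerivAt_qFun hr) (qFun_pos hr).ne'
  refine strictAntiOn_of_deriv_neg (convex_Ioo _ _)
    (fun r hr => (key r hr).continuousAt.continuousWithinAt) fun r hr => ?_
  rw [interior_Ioo] at hr
  rw [(key r hr).deriv]
  have hq := qFun_pos hr
  have h2 : 0 ≤ (3 * M - 2 * r) * (r ^ 2 * (3 * M - 2 * r) / qFun M r) := by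
    rw [show (3 * M - 2 * r) * (r ^ 2 * (3 * M - 2 * r) / qFun M r) =
      (r * (3 * M - 2 * r)) ^ 2 / qFun M r by ring]
    positivity
  exact div_neg_of_neg_of_pos (by linarith) (by positivity)

/-- `k_H'` has exactly one zero `r₀`, is negative before it and positive after it. -/
theorem exists_crit_sign {M : ℝ} (hM : 0 < M) (H : ℝ) : ∃ r₀ ∈ Ioo 0 (2 * M),
    crit M H r₀ = 0 ∧ (∀ r ∈ Ioo 0 r₀, 0 < crit M H r) ∧ ∀ r ∈ Ioo r₀ (2 * M), crit M H r < 0 := by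
  have h1 : (0 : ℝ) ∈ Ioo (crit M H (2 * M)) (crit M H 0) := by
    constructor <;> simp [crit, qFun] <;> linarith
  obtain ⟨r₀, hr₀, h2⟩ := intermediate_value_Ioo' (by linarith : (0 : ℝ) ≤ 2 * M)
    (continuous_crit M H).continuousOn h1
  have h3 : ∀ r ∈ Ioo 0 (2 * M),
      crit M H r = qFun M r * (3 * H + (3 * M - 2 * r) / qFun M r) := fun r hr => by
    have := qFun_pos hr
    unfold crit; field_simp; ring
  have h4 : 3 * H + (3 * M - 2 * r₀) / qFun M r₀ = 0 := by
    have := h3 r₀ hr₀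
    rw [h2, eq_comm, mul_eq_zero] at this
    exact this.resolve_left (qFun_pos hr₀).ne'
  refine ⟨r₀, hr₀, h2, fun r hr => ?_, fun r hr => ?_⟩
  · have hr' : r ∈ Ioo 0 (2 * M) := ⟨hr.1, hr.2.trans hr₀.2⟩
    have := strictAntiOn_div_qFun M hr' hr₀ hr.2
    rw [h3 r hr']
    exact mul_pos (qFun_pos hr') (by simp only at this; linarith)
  · have hr' : r ∈ Ioo 0 (2 * M) := ⟨hr₀.1.trans hr.1, hr.2⟩
    have := strictAntiOn_div_qFun M hr₀ hr' hr.1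
    rw [h3 r hr']
    exact mul_neg_of_pos_of_neg (qFun_pos hr') (by simp only at this; linarith)

/-- The zero of `k_H'` is the only minimum point of `k_H`, so it is the chosen point `rMin`. -/
theorem rMin_spec {M : ℝ} (hM : 0 < M) (H : ℝ) : rMin M H ∈ Ioo 0 (2 * M) ∧
    k M H (rMin M H) = cMin M H ∧ crit M H (rMin M H) = 0 ∧
    (∀ r ∈ Ioo 0 (rMin M H), 0 < crit M H r) ∧ StrictAntiOn (k M H) (Icc 0 (rMin M H)) := by
  obtain ⟨r₀, hr₀, h0, hpos, hneg⟩ := exists_crit_sign hM H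
  have hanti : StrictAntiOn (k M H) (Icc 0 r₀) := by
    refine strictAntiOn_of_deriv_neg (convex_Icc _ _)
      ((continuousOn_k M H).mono (Icc_subset_Icc_right hr₀.2.le)) fun r hr => ?_
    rw [interior_Icc] at hr
    have hr' : r ∈ Ioo 0 (2 * M) := ⟨hr.1, hr.2.trans hr₀.2⟩
    rw [(hasDerivAt_k H hr').deriv, neg_mul, neg_lt_zero]
    exact mul_pos (div_pos (pow_pos hr.1 2) (qFun_pos hr')) (hpos r hr)
  have hmono : StrictMonoOn (k M H) (Icc r₀ (2 * M)) := by
    refine strictMonoOn_of_deriv_pos (convex_Icc _ _)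
      ((continuousOn_k M H).mono (Icc_subset_Icc_left hr₀.1.le)) fun r hr => ?_
    rw [interior_Icc] at hr
    have hr' : r ∈ Ioo 0 (2 * M) := ⟨hr₀.1.trans hr.1, hr.2⟩
    rw [(hasDerivAt_k H hr').deriv, neg_mul, neg_pos]
    exact mul_neg_of_pos_of_neg (div_pos (pow_pos hr'.1 2) (qFun_pos hr')) (hneg r hr)
  have hlt : ∀ r ∈ Ioo 0 (2 * M), r ≠ r₀ → k M H r₀ < k M H r := fun r hr hne => by
    rcases lt_or_gt_of_ne hne with h | h
    · exact hanti ⟨hr.1.le, h.le⟩ ⟨hr₀.1.le, le_rfl⟩ h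
    · exact hmono ⟨le_rfl, hr₀.2.le⟩ ⟨h.le, hr.2.le⟩ h
  have hc : cMin M H = k M H r₀ := by
    refine IsLeast.csInf_eq ⟨mem_image_of_mem _ hr₀, ?_⟩
    rintro _ ⟨r, hr, rfl⟩
    rcases eq_or_ne r r₀ with rfl | h
    · exact le_rfl
    · exact (hlt r hr h).le
  have hex : ∃ r ∈ Ioo 0 (2 * M), k M H r = cMin M H := ⟨r₀, hr₀, hc.symm⟩
  have hr : rMin M H = r₀ := by
    by_contra hne
    have h1 := hlt (rMin M H) (Function.invFunOn_mem hex) hne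
    have h2 : k M H (rMin M H) = cMin M H := Function.invFunOn_eq hex
    rw [h2, hc] at h1
    exact lt_irrefl _ h1
  rw [hr]
  exact ⟨hr₀, hc.symm, h0, hpos, hanti⟩

theorem mem_Ioo_two_mul {M H r : ℝ} (hM : 0 < M) (hr : r ∈ Ioo 0 (rMin M H)) :
    r ∈ Ioo 0 (2 * M) :=
  ⟨hr.1, hr.2.trans (rMin_spec hM H).1.2⟩

theorem k_mem_Ioo {M H r : ℝ} (hM : 0 < M) (hr : r ∈ Ioo 0 (rMin M H)) :
    k M H r ∈ Ioo (cMin M H) 0 := by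
  obtain ⟨h1, h2, -, -, h3⟩ := rMin_spec hM H
  refine ⟨?_, ?_⟩
  · rw [← h2]
    exact h3 ⟨hr.1.le, hr.2.le⟩ ⟨h1.1.le, le_rfl⟩ hr.2
  · rw [← k_zero (M := M) H]
    exact h3 ⟨le_rfl, h1.1.le⟩ ⟨hr.1.le, hr.2.le⟩ hr.1

theorem exists_k_eq {M H c : ℝ} (hM : 0 < M) (hc : c ∈ Ioo (cMin M H) 0) :
    ∃ r ∈ Ioo 0 (rMin M H), k M H r = c := by
  obtain ⟨h1, h2, -⟩ := rMin_spec hM H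
  refine intermediate_value_Ioo' h1.1.le
    ((continuousOn_k M H).mono (Icc_subset_Icc_right h1.2.le)) ?_
  rwa [h2, k_zero]

theorem rMinus_mem {M H c : ℝ} (hM : 0 < M) (hc : c ∈ Ioo (cMin M H) 0) :
    rMinus M H c ∈ Ioo 0 (rMin M H) :=
  Function.invFunOn_mem (exists_k_eq hM hc)

theorem k_rMinus {M H c : ℝ} (hM : 0 < M) (hc : c ∈ Ioo (cMin M H) 0) :
    k M H (rMinus M H c) = c :=
  Function.invFunOn_eq (exists_k_eq hM hc)

theorem k_lt_k_iff {M H r r' : ℝ} (hM : 0 < M) (hr : r ∈ Ioo 0 (rMin M H))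
    (hr' : r' ∈ Ioo 0 (rMin M H)) : k M H r < k M H r' ↔ r' < r :=
  (rMin_spec hM H).2.2.2.2.lt_iff_gt (Ioo_subset_Icc_self hr) (Ioo_subset_Icc_self hr')

theorem rMinus_k {M H r : ℝ} (hM : 0 < M) (hr : r ∈ Ioo 0 (rMin M H)) :
    rMinus M H (k M H r) = r :=
  (rMin_spec hM H).2.2.2.2.injOn (Ioo_subset_Icc_self (rMinus_mem hM (k_mem_Ioo hM hr)))
    (Ioo_subset_Icc_self hr) (k_rMinus hM (k_mem_Ioo hM hr))

theorem lt_rMinus_iff {M H r c : ℝ} (hM : 0 < M) (hr : r ∈ Ioo 0 (rMin M H))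
    (hc : c ∈ Ioo (cMin M H) 0) : r < rMinus M H c ↔ c < k M H r := by
  rw [← k_lt_k_iff hM (rMinus_mem hM hc) hr, k_rMinus hM hc]

theorem rMinus_lt_iff {M H r c : ℝ} (hM : 0 < M) (hr : r ∈ Ioo 0 (rMin M H))
    (hc : c ∈ Ioo (cMin M H) 0) : rMinus M H c < r ↔ k M H r < c := by
  rw [← k_lt_k_iff hM hr (rMinus_mem hM hc), k_rMinus hM hc]

theorem cMin_neg {M : ℝ} (hM : 0 < M) (H : ℝ) : cMin M H < 0 := by
  have h1 := (rMin_spec hM H).1.1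
  have := k_mem_Ioo (H := H) hM (r := rMin M H / 2) ⟨by linarith, by linarith⟩
  exact this.1.trans this.2

theorem tendsto_rMinus_cMin {M : ℝ} (hM : 0 < M) (H : ℝ) :
    Tendsto (rMinus M H) (𝓝[>] (cMin M H)) (𝓝[<] (rMin M H)) := by
  have hI : ∀ᶠ c in 𝓝[>] (cMin M H), c ∈ Ioo (cMin M H) 0 := Ioo_mem_nhdsGT (cMin_neg hM H)
  have h0 := (rMin_spec hM H).1.1
  refine tendsto_nhdsWithin_iff.2 ⟨tendsto_order.2 ⟨fun a ha => ?_, fun a ha => ?_⟩, ?_⟩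
  · have hb : max a (rMin M H / 2) ∈ Ioo 0 (rMin M H) :=
      ⟨lt_max_of_lt_right (by linarith), max_lt ha (by linarith)⟩
    filter_upwards [hI, Ioo_mem_nhdsGT (k_mem_Ioo hM hb).1] with c hc hc'
    exact (le_max_left _ _).trans_lt ((lt_rMinus_iff hM hb hc).2 hc'.2)
  · filter_upwards [hI] with c hc using (rMinus_mem hM hc).2.trans ha
  · filter_upwards [hI] with c hc using (rMinus_mem hM hc).2

theorem tendsto_rMinus_zero {M : ℝ} (hM : 0 < M) (H : ℝ) :
    Tendsto (rMinus M H) (𝓝[<] 0) (𝓝[>] 0) := by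
  have hI : ∀ᶠ c in 𝓝[<] (0 : ℝ), c ∈ Ioo (cMin M H) 0 := Ioo_mem_nhdsLT (cMin_neg hM H)
  have h0 := (rMin_spec hM H).1.1
  refine tendsto_nhdsWithin_iff.2 ⟨tendsto_order.2 ⟨fun a ha => ?_, fun a ha => ?_⟩, ?_⟩
  · filter_upwards [hI] with c hc using ha.trans (rMinus_mem hM hc).1
  · have hb : min a (rMin M H / 2) ∈ Ioo 0 (rMin M H) :=
      ⟨lt_min ha (by linarith), (min_le_right _ _).trans_lt (by linarith)⟩
    filter_upwards [hI, Ioo_mem_nhdsLT (k_mem_Ioo hM hb).2] with c hc hc'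
    exact ((rMinus_lt_iff hM hb hc).2 hc'.1).trans_le (min_le_left _ _)
  · filter_upwards [hI] with c hc using (rMinus_mem hM hc).1

theorem continuousAt_rMinus {M H c : ℝ} (hM : 0 < M) (hc : c ∈ Ioo (cMin M H) 0) :
    ContinuousAt (rMinus M H) c := by
  have hI : ∀ᶠ c in 𝓝 c, c ∈ Ioo (cMin M H) 0 := isOpen_Ioo.mem_nhds hc
  have hR := rMinus_mem hM hc
  refine tendsto_order.2 ⟨fun a ha => ?_, fun a ha => ?_⟩
  · obtain ⟨b, hb1, hb2⟩ := exists_between (max_lt ha hR.1)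
    have hb : b ∈ Ioo 0 (rMin M H) := ⟨(le_max_right _ _).trans_lt hb1, hb2.trans hR.2⟩
    filter_upwards [hI, Iio_mem_nhds ((lt_rMinus_iff hM hb hc).1 hb2)] with c hc hc'
    exact ((le_max_left _ _).trans_lt hb1).trans ((lt_rMinus_iff hM hb hc).2 hc')
  · obtain ⟨b, hb1, hb2⟩ := exists_between (lt_min ha hR.2)
    have hb : b ∈ Ioo 0 (rMin M H) := ⟨hR.1.trans hb1, hb2.trans_le (min_le_right _ _)⟩
    filter_upwards [hI, Ioi_mem_nhds ((rMinus_lt_iff hM hb hc).1 hb1)] with c hc hc'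
    exact ((rMinus_lt_iff hM hb hc).2 hc').trans (hb2.trans_le (min_le_left _ _))

theorem hasDerivAt_rMinus {M H c : ℝ} (hM : 0 < M) (hc : c ∈ Ioo (cMin M H) 0) :
    ∃ d < 0, HasDerivAt (rMinus M H) d c := by
  have hR := rMinus_mem hM hc
  have hR' := mem_Ioo_two_mul hM hR
  have hneg : -(rMinus M H c ^ 2 / qFun M (rMinus M H c)) * crit M H (rMinus M H c) < 0 := by
    rw [neg_mul, neg_lt_zero]
    exact mul_pos (div_pos (pow_pos hR.1 2) (qFun_pos hR')) ((rMin_spec hM H).2.2.2.1 _ hR)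
  refine ⟨_, inv_lt_zero.2 hneg, HasDerivAt.of_local_left_inverse (continuousAt_rMinus hM hc)
    (hasDerivAt_k H hR') hneg.ne ?_⟩
  filter_upwards [isOpen_Ioo.mem_nhds hc] with x hx using k_rMinus hM hx

/-! ### A smooth parametrization of the profile curve -/

/-- The polynomial `D(x) = (H x³ + c)² - x³ (2M - x)`, which on `(0, 2M)` is a
positive multiple of `l² - 1`. -/
def disc (M H c x : ℝ) : ℝ := (H * x ^ 3 + c) ^ 2 - x ^ 3 * (2 * M - x)

/-- The quotient `D(R y) / (R³ (1 - y))` for `c = k_H(R)`, a polynomial in `y` because `R` is a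
root of `D`. -/
noncomputable def discQuot (M H R y : ℝ) : ℝ :=
  (y ^ 2 + y + 1) * (H ^ 2 * R ^ 3 * (1 - y ^ 3) + 2 * H * qFun M R + 2 * M) -
    R * (y + 1) * (y ^ 2 + 1)

/-- The derivative `-dt/dr` along the half `t ≥ 0` of the profile curve. -/
noncomputable def steep (M H c x : ℝ) : ℝ :=
  x / (2 * M - x) * ((-H * x ^ 3 - c) / √(disc M H c x))

/-- The derivative `dt/dσ` along the profile curve with `c = k_H(R)`, where `r = R (1 - σ²)`.
In contrast to `dt/dr` it has no singularity at the turning point `r = R`. -/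
noncomputable def speed (M H : ℝ) (p : ℝ × ℝ) : ℝ :=
  2 * p.1 ^ 2 * (1 - p.2 ^ 2) / (2 * M - p.1 * (1 - p.2 ^ 2)) *
    (H * (p.1 * √p.1) * (1 - (1 - p.2 ^ 2) ^ 3) + √(2 * M - p.1)) /
      √(discQuot M H p.1 (1 - p.2 ^ 2))

/-- The time coordinate `t` along the profile curve with `c = k_H(R)`, as a function of the
parameter `σ ∈ (-1, 1)` for which `r = R (1 - σ²)`. -/
noncomputable def time (M H R σ : ℝ) : ℝ := ∫ x in (0 : ℝ)..σ, speed M H (R, x)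

theorem disc_mul {M R : ℝ} (H : ℝ) (h0 : 0 ≤ R) (h1 : R ≤ 2 * M) (y : ℝ) :
    disc M H (k M H R) (R * y) = R ^ 3 * (1 - y) * discQuot M H R y := by
  have hq := qFun_sq h0 h1
  rw [disc, discQuot, k_eq H h0]
  linear_combination hq

theorem disc_eq_mul (M H c : ℝ) {x : ℝ} (h0 : 0 ≤ x) (h1 : x ≤ 2 * M) :
    disc M H c x = (k M H x - c) * (-H * x ^ 3 - c + qFun M x) := by
  have hq := qFun_sq h0 h1
  rw [disc, k_eq H h0]
  linear_combination hq

theorem qFun_lt {M H R x : ℝ} (hM : 0 < M) (hR : R ∈ Ioo 0 (rMin M H)) (hx : x ∈ Ioo 0 R) :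
    qFun M x < -H * x ^ 3 - k M H R := by
  have := (k_lt_k_iff hM hR ⟨hx.1, hx.2.trans hR.2⟩).2 hx.2
  rw [k_eq H hx.1.le] at this
  linarith

theorem disc_pos {M H R x : ℝ} (hM : 0 < M) (hR : R ∈ Ioo 0 (rMin M H)) (hx : x < R) :
    0 < disc M H (k M H R) x := by
  have hR' := mem_Ioo_two_mul hM hR
  rcases lt_trichotomy x 0 with h | rfl | h
  · have h3 : 0 < (-x) ^ 3 * (2 * M - x) := mul_pos (pow_pos (neg_pos.2 h) 3) (by linarith)
    rw [disc]
    nlinarith [sq_nonneg (H * x ^ 3 + k M H R)]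
  · have := (k_mem_Ioo hM hR).2
    simp only [disc]
    have : 0 < k M H R ^ 2 := sq_pos_of_neg this
    simpa using this
  · have h2 : x < 2 * M := hx.trans hR'.2
    have h3 := qFun_lt hM hR ⟨h, hx⟩
    have h4 := qFun_pos ⟨h, h2⟩
    rw [disc_eq_mul _ _ _ h.le h2.le]
    exact mul_pos (sub_pos.2 ((k_lt_k_iff hM hR ⟨h, hx.trans hR.2⟩).2 hx)) (by linarith)

theorem discQuot_one (M H R : ℝ) : discQuot M H R 1 = 2 * crit M H R := by
  rw [discQuot, crit]; ring

theorem discQuot_pos {M H R y : ℝ} (hM : 0 < M) (hR : R ∈ Ico 0 (rMin M H)) (hy : y ≤ 1) :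
    0 < discQuot M H R y := by
  rcases hR.1.eq_or_lt with rfl | h0
  · have : 0 < y ^ 2 + y + 1 := by nlinarith [sq_nonneg (y + 1 / 2)]
    simp only [discQuot, qFun]
    norm_num
    positivity
  have hR' : R ∈ Ioo 0 (rMin M H) := ⟨h0, hR.2⟩
  rcases hy.eq_or_lt with rfl | hy
  · rw [discQuot_one]
    have := (rMin_spec hM H).2.2.2.1 R hR'
    positivity
  have h1 := disc_pos hM hR' (x := R * y) (by nlinarith)
  rw [disc_mul H h0.le (mem_Ioo_two_mul hM hR').2.le] at h1
  exact pos_of_mul_pos_right h1 (mul_pos (pow_pos h0 3) (sub_pos.2 hy)).le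

theorem mul_one_sub_sq_lt {M H R : ℝ} (hM : 0 < M) (hR : R ∈ Ico 0 (rMin M H)) (σ : ℝ) :
    0 < 2 * M - R * (1 - σ ^ 2) := by
  have := hR.2.trans (rMin_spec hM H).1.2
  nlinarith [mul_nonneg hR.1 (sq_nonneg σ)]

/-- The parameter value `R = 0`, which belongs to no leaf, is included for the limit `c → 0⁻`. -/
theorem continuousOn_speed {M : ℝ} (hM : 0 < M) (H : ℝ) :
    ContinuousOn (speed M H) (Ico 0 (rMin M H) ×ˢ univ) := by
  have hq := continuous_qFun M
  have h1 : Continuous fun p : ℝ × ℝ => discQuot M H p.1 (1 - p.2 ^ 2) := by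
    unfold discQuot; fun_prop
  refine ContinuousOn.div (ContinuousOn.mul (ContinuousOn.div (by fun_prop) (by fun_prop) ?_)
    (by fun_prop)) (h1.sqrt.continuousOn) ?_
  · exact fun p hp => (mul_one_sub_sq_lt hM hp.1 p.2).ne'
  · exact fun p hp => (Real.sqrt_pos.2 (discQuot_pos hM hp.1
      (by linarith [sq_nonneg p.2]))).ne'

theorem contDiffOn_speed {M : ℝ} (hM : 0 < M) (H : ℝ) :
    ContDiffOn ℝ ∞ (speed M H) (Ioo 0 (rMin M H) ×ˢ univ) := by
  intro p hp
  have h1 : p.1 ≠ 0 := hp.1.1.ne'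
  have h2 : 2 * M - p.1 ≠ 0 := (sub_pos.2 (mem_Ioo_two_mul hM hp.1).2).ne'
  have h3 := (mul_one_sub_sq_lt hM (Ioo_subset_Ico_self hp.1) p.2).ne'
  have h4 := discQuot_pos hM (Ioo_subset_Ico_self hp.1) (y := 1 - p.2 ^ 2)
    (by linarith [sq_nonneg p.2])
  have hs1 : ContDiffAt ℝ ∞ (fun p : ℝ × ℝ => √p.1) p := contDiffAt_fst.sqrt h1
  have hs2 : ContDiffAt ℝ ∞ (fun p : ℝ × ℝ => √(2 * M - p.1)) p :=
    (contDiffAt_const.sub contDiffAt_fst).sqrt h2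
  have hs3 : ContDiffAt ℝ ∞ (fun p : ℝ × ℝ => discQuot M H p.1 (1 - p.2 ^ 2)) p := by
    unfold discQuot qFun; fun_prop
  have hs4 := hs3.sqrt h4.ne'
  refine ContDiffAt.contDiffWithinAt ?_
  refine ContDiffAt.div (ContDiffAt.mul (ContDiffAt.div (by fun_prop) (by fun_prop) h3)
    (by fun_prop)) hs4 (Real.sqrt_pos.2 h4).ne'

theorem continuousOn_time {M : ℝ} (hM : 0 < M) (H : ℝ) :
    ContinuousOn (fun p : ℝ × ℝ => time M H p.1 p.2) (Ico 0 (rMin M H) ×ˢ univ) :=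
  continuousOn_parametric_primitive (continuousOn_speed hM H)

theorem contDiffOn_time {M : ℝ} (hM : 0 < M) (H : ℝ) :
    ContDiffOn ℝ ∞ (fun p : ℝ × ℝ => time M H p.1 p.2) (Ioo 0 (rMin M H) ×ˢ univ) :=
  contDiffOn_parametric_primitive isOpen_Ioo (contDiffOn_speed hM H)

theorem hasDerivAt_time {M H R : ℝ} (hM : 0 < M) (hR : R ∈ Ioo 0 (rMin M H)) (σ : ℝ) :
    HasDerivAt (time M H R) (speed M H (R, σ)) σ :=
  hasDerivAt_parametric_primitive_right (continuousOn_speed hM H) (Ioo_subset_Ico_self hR) σ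

theorem time_zero (M H R : ℝ) : time M H R 0 = 0 := by simp [time]

theorem time_neg (M H R σ : ℝ) : time M H R (-σ) = -time M H R σ := by
  have h1 : ∀ x, speed M H (R, -x) = speed M H (R, x) := fun x => by simp [speed]
  have h2 := intervalIntegral.integral_comp_neg (fun x => speed M H (R, x)) (a := 0) (b := σ)
  simp only [h1, neg_zero] at h2
  rw [time, time, h2, intervalIntegral.integral_symm]

theorem mul_one_sub_sq_mem {R σ : ℝ} (hR : 0 < R) (hσ : σ ∈ Ioo 0 1) :
    R * (1 - σ ^ 2) ∈ Ioo 0 R := by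
  have h1 : σ ^ 2 < 1 := by nlinarith [hσ.1, hσ.2]
  have h2 : 0 < σ ^ 2 := pow_pos hσ.1 2
  constructor <;> nlinarith

theorem sqrt_disc {M H R σ : ℝ} (hM : 0 < M) (hR : R ∈ Ioo 0 (rMin M H)) (hσ : 0 ≤ σ) :
    √(disc M H (k M H R) (R * (1 - σ ^ 2))) = R * √R * σ * √(discQuot M H R (1 - σ ^ 2)) := by
  have hR0 := hR.1
  have h4 := discQuot_pos hM (Ioo_subset_Ico_self hR) (y := 1 - σ ^ 2)
    (by linarith [sq_nonneg σ])
  rw [disc_mul H hR.1.le (mem_Ioo_two_mul hM hR).2.le,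
    show R ^ 3 * (1 - (1 - σ ^ 2)) * discQuot M H R (1 - σ ^ 2) =
      (R * σ) ^ 2 * R * discQuot M H R (1 - σ ^ 2) by ring,
    Real.sqrt_mul (by positivity), Real.sqrt_mul (by positivity), Real.sqrt_sq (by positivity)]
  ring

theorem neg_mul_sub_k {M H R : ℝ} (hR : 0 ≤ R) (y : ℝ) :
    -H * (R * y) ^ 3 - k M H R =
      R * √R * (H * (R * √R) * (1 - y ^ 3) + √(2 * M - R)) := by
  rw [k_eq H hR, qFun]
  have := Real.sq_sqrt hR
  linear_combination (-H * R ^ 2 * (1 - y ^ 3)) * this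

theorem speed_eq {M H R σ : ℝ} (hM : 0 < M) (hR : R ∈ Ioo 0 (rMin M H)) (hσ : 0 < σ) :
    speed M H (R, σ) = 2 * R * σ * steep M H (k M H R) (R * (1 - σ ^ 2)) := by
  have hR0 := hR.1
  have h3 := (mul_one_sub_sq_lt hM (Ioo_subset_Ico_self hR) σ)
  have h4 := Real.sqrt_pos.2 (discQuot_pos hM (Ioo_subset_Ico_self hR) (y := 1 - σ ^ 2)
    (by linarith [sq_nonneg σ]))
  have h5 := Real.sqrt_pos.2 hR0
  rw [steep, sqrt_disc hM hR hσ.le, neg_mul_sub_k hR0.le, speed]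
  field_simp

theorem steep_pos {M H R x : ℝ} (hM : 0 < M) (hR : R ∈ Ioo 0 (rMin M H)) (hx : x ∈ Ioo 0 R) :
    0 < steep M H (k M H R) x := by
  have h2 : x < 2 * M := hx.2.trans (mem_Ioo_two_mul hM hR).2
  have h3 := qFun_lt hM hR hx
  have h4 := qFun_pos ⟨hx.1, h2⟩
  exact mul_pos (div_pos hx.1 (by linarith))
    (div_pos (by linarith) (Real.sqrt_pos.2 (disc_pos hM hR hx.2)))

/-- The slope of the height function in terms of the polynomial `D`; the sign is that of `h`. -/
theorem slope_eq {M H R x : ℝ} (hM : 0 < M) (hR : R ∈ Ioo 0 (rMin M H)) (hx : x ∈ Ioo 0 R) :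
    slope M H (k M H R) x = -steep M H (k M H R) x := by
  have h0 := hx.1
  have h2 : 0 < 2 * M - x := by linarith [hx.2, (mem_Ioo_two_mul hM hR).2]
  have h3 := qFun_lt hM hR hx
  have h4 := qFun_pos ⟨hx.1, sub_pos.1 h2⟩
  have hD := disc_pos hM hR hx.2
  set c := k M H R
  have hh : -h M x = (2 * M - x) / x := by rw [h]; field_simp; ring
  have hl : l M H c x ^ 2 = (-H * x ^ 3 - c) ^ 2 / (x ^ 3 * (2 * M - x)) := by
    rw [l, mul_pow, div_pow, Real.sq_sqrt (by rw [hh]; positivity), hh]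
    field_simp
  have hl' : l M H c x ^ 2 - 1 = disc M H c x / (x ^ 3 * (2 * M - x)) := by
    rw [hl, disc]; field_simp; ring
  have hr : l M H c x ^ 2 / (l M H c x ^ 2 - 1) = (-H * x ^ 3 - c) ^ 2 / disc M H c x := by
    rw [hl', hl]; field_simp
  have hh' : h M x = -((2 * M - x) / x) := by rw [← hh, neg_neg]
  rw [slope, hr, Real.sqrt_div (sq_nonneg _), Real.sqrt_sq (by linarith), hh', steep]
  have := Real.sqrt_pos.2 hD
  field_simp

theorem sqrt_one_sub_div {R x : ℝ} (hR : 0 < R) (hx : x ≤ R) : R * (1 - √(1 - x / R) ^ 2) = x := by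
  rw [Real.sq_sqrt (by rw [sub_nonneg, div_le_one hR]; exact hx)]
  field_simp; ring

theorem sqrt_one_sub_div_mem {R x : ℝ} (hx : x ∈ Ioo 0 R) : √(1 - x / R) ∈ Ioo 0 1 := by
  have hR := hx.1.trans hx.2
  have h1 : x / R < 1 := (div_lt_one hR).2 hx.2
  have h2 : 0 < x / R := div_pos hx.1 hR
  exact ⟨Real.sqrt_pos.2 (by linarith), (Real.sqrt_lt' one_pos).2 (by linarith)⟩

theorem hasDerivAt_time_sqrt {M H R x : ℝ} (hM : 0 < M) (hR : R ∈ Ioo 0 (rMin M H))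
    (hx : x ∈ Ioo 0 R) :
    HasDerivAt (fun x => time M H R √(1 - x / R)) (slope M H (k M H R) x) x := by
  have hR0 := hR.1
  have h1 := sqrt_one_sub_div_mem hx
  have h2 : HasDerivAt (fun x => 1 - x / R) (-(1 / R)) x :=
    ((hasDerivAt_id x).div_const R).const_sub 1
  have h3 := (hasDerivAt_time hM hR √(1 - x / R)).comp x (h2.sqrt (Real.sqrt_pos.1 h1.1).ne')
  refine h3.congr_deriv ?_
  rw [speed_eq hM hR h1.1, sqrt_one_sub_div hR0 hx.2.le, slope_eq hM hR hx]
  have h4 := h1.1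
  generalize √(1 - x / R) = s at h4 ⊢
  field_simp

theorem continuous_time_sqrt {M H R : ℝ} (hM : 0 < M) (hR : R ∈ Ioo 0 (rMin M H)) :
    Continuous (fun x => time M H R √(1 - x / R)) := by
  have h1 : Continuous (time M H R) :=
    continuous_iff_continuousAt.2 fun σ => (hasDerivAt_time hM hR σ).continuousAt
  fun_prop

/-- The slope has a fixed sign and a continuous primitive, hence it is integrable. -/
theorem intervalIntegrable_slope {M H R x : ℝ} (hM : 0 < M) (hR : R ∈ Ioo 0 (rMin M H))
    (hx : x ∈ Icc 0 R) :
    IntervalIntegrable (slope M H (k M H R)) MeasureTheory.volume x R := by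
  have h1 := intervalIntegral.intervalIntegrable_deriv_of_nonneg (a := x) (b := R)
    (g := fun x => -time M H R √(1 - x / R)) (g' := fun x => -slope M H (k M H R) x)
    (continuous_time_sqrt hM hR).neg.continuousOn ?_ ?_
  · simpa [Pi.neg_def] using h1.neg
  all_goals
    rw [min_eq_left hx.2, max_eq_right hx.2]
    intro y hy
    have hy' : y ∈ Ioo 0 R := ⟨hx.1.trans_lt hy.1, hy.2⟩
  · exact (hasDerivAt_time_sqrt hM hR hy').neg
  · rw [slope_eq hM hR hy', neg_neg]
    exact (steep_pos hM hR hy').le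

/-- The height function in terms of `time`: the point of radius `x` has `σ = √(1 - x / R)`. -/
theorem height_eq {M H R x : ℝ} (hM : 0 < M) (hR : R ∈ Ioo 0 (rMin M H)) (hx : x ∈ Icc 0 R) :
    height M H (k M H R) x = time M H R √(1 - x / R) := by
  have h1 := intervalIntegral.integral_eq_sub_of_hasDerivAt_of_le hx.2
    (continuous_time_sqrt hM hR).continuousOn
    (fun y hy => hasDerivAt_time_sqrt hM hR ⟨hx.1.trans_lt hy.1, hy.2⟩)
    (intervalIntegrable_slope hM hR hx)
  rw [height, rMinus_k hM hR, intervalIntegral.integral_symm, h1, div_self hR.1.ne']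
  simp [time_zero]

theorem height_mul {M H R σ : ℝ} (hM : 0 < M) (hR : R ∈ Ioo 0 (rMin M H)) (hσ : σ ∈ Icc 0 1) :
    height M H (k M H R) (R * (1 - σ ^ 2)) = time M H R σ := by
  have hR0 := hR.1
  have h1 : σ ^ 2 ≤ 1 := by nlinarith [hσ.1, hσ.2]
  have h2 : 0 ≤ σ ^ 2 := sq_nonneg σ
  rw [height_eq hM hR ⟨by nlinarith, by nlinarith⟩,
    show 1 - R * (1 - σ ^ 2) / R = σ ^ 2 by field_simp; ring, Real.sqrt_sq hσ.1]

/-! ### Monotonicity of the family at fixed radius -/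

/-- The derivative of `time M H R σ` with respect to `R`. -/
noncomputable def timeDeriv (M H R σ : ℝ) : ℝ :=
  ∫ x in (0 : ℝ)..σ, fderiv ℝ (speed M H) (R, x) (1, 0)

/-- The rate of change of `t` with respect to `R` at fixed radius `r = R (1 - σ²)`. -/
noncomputable def fixedRadiusDeriv (M H R σ : ℝ) : ℝ :=
  timeDeriv M H R σ + (1 - σ ^ 2) * steep M H (k M H R) (R * (1 - σ ^ 2))

/-- The polynomial `p = (x D' - 4 D) / 2` with `D = disc M H c`; the sign of `p` is
that of the derivative of `D(r) / r⁴ = (dr/ds)²`, where `s` is the proper length along the profile curve. -/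
def discAux (M H c x : ℝ) : ℝ := (H * x ^ 3 + c) * (H * x ^ 3 - 2 * c) + M * x ^ 3

/-- The function `β = r⁵ / (p √D)`, the singular part of the derivative of `t` with respect to
`c` at fixed radius. -/
noncomputable def beta (M H c x : ℝ) : ℝ := x ^ 5 / (discAux M H c x * √(disc M H c x))

theorem contDiffOn_one_speed {M : ℝ} (hM : 0 < M) (H : ℝ) :
    ContDiffOn ℝ 1 (speed M H) (Ioo 0 (rMin M H) ×ˢ univ) :=
  (contDiffOn_speed hM H).of_le (by norm_cast)

theorem hasFDerivAt_time {M H R : ℝ} (hM : 0 < M) (hR : R ∈ Ioo 0 (rMin M H)) (σ : ℝ) :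
    HasFDerivAt (fun p : ℝ × ℝ => time M H p.1 p.2)
      (timeDeriv M H R σ • ContinuousLinearMap.fst ℝ ℝ ℝ +
        speed M H (R, σ) • ContinuousLinearMap.snd ℝ ℝ ℝ) (R, σ) :=
  hasFDerivAt_parametric_primitive isOpen_Ioo (contDiffOn_one_speed hM H) (p := (R, σ))
    ⟨hR, mem_univ _⟩

theorem hasDerivAt_time_left {M H R : ℝ} (hM : 0 < M) (hR : R ∈ Ioo 0 (rMin M H)) (σ : ℝ) :
    HasDerivAt (fun R => time M H R σ) (timeDeriv M H R σ) R :=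
  hasDerivAt_parametric_primitive_left isOpen_Ioo (contDiffOn_one_speed hM H) hR σ

theorem continuous_timeDeriv {M H R : ℝ} (hM : 0 < M) (hR : R ∈ Ioo 0 (rMin M H)) :
    Continuous fun x => fderiv ℝ (speed M H) (R, x) (1, 0) :=
  continuous_slice (G := fun p => fderiv ℝ (speed M H) p (1, 0))
    (((contDiffOn_one_speed hM H).continuousOn_fderiv_of_isOpen
      (isOpen_Ioo.prod isOpen_univ) le_rfl).clm_apply continuousOn_const) hR

theorem timeDeriv_neg {M H R : ℝ} (hM : 0 < M) (hR : R ∈ Ioo 0 (rMin M H)) (σ : ℝ) :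
    timeDeriv M H R (-σ) = -timeDeriv M H R σ := by
  have h1 := hasDerivAt_time_left hM hR (-σ)
  simp only [time_neg] at h1
  exact h1.unique (hasDerivAt_time_left hM hR σ).neg

theorem hasDerivAt_disc (M H c x : ℝ) : HasDerivAt (disc M H c)
    (6 * H * x ^ 2 * (H * x ^ 3 + c) - 6 * M * x ^ 2 + 4 * x ^ 3) x := by
  have h1 : HasDerivAt (fun x => H * x ^ 3 + c) (H * (3 * x ^ 2)) x := by
    simpa using ((hasDerivAt_pow 3 x).const_mul H).add_const c
  have h2 : HasDerivAt (fun x : ℝ => x ^ 3 * (2 * M - x))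
      (3 * x ^ 2 * (2 * M - x) + x ^ 3 * (-1)) x := by
    simpa using (hasDerivAt_pow 3 x).fun_mul ((hasDerivAt_id x).const_sub (2 * M))
  refine ((h1.fun_pow 2).fun_sub h2).congr_deriv ?_
  norm_num; ring

/-- The function `p(x) / x³ = H² x³ - c H - 2 c² / x³ + M` increases, and `p(R) = -R³ Q(R) < 0`. -/
theorem discAux_neg {M H R x : ℝ} (hM : 0 < M) (hR : R ∈ Ioo 0 (rMin M H)) (hx : x ∈ Icc 0 R) :
    discAux M H (k M H R) x < 0 := by
  have hR0 := hR.1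
  have hc := sq_pos_of_neg (k_mem_Ioo hM hR).2
  have h1 : discAux M H (k M H R) R = -(R ^ 3 * crit M H R) := by
    have hq := qFun_sq hR.1.le (mem_Ioo_two_mul hM hR).2.le
    rw [discAux, crit, k_eq H hR.1.le]
    linear_combination (-2) * hq
  have h2 : discAux M H (k M H R) x * R ^ 3 = discAux M H (k M H R) R * x ^ 3 -
      (R ^ 3 - x ^ 3) * (H ^ 2 * x ^ 3 * R ^ 3 + 2 * k M H R ^ 2) := by
    simp only [discAux]; ring
  refine neg_of_mul_neg_left (b := R ^ 3) ?_ (by positivity)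
  have hcr := (rMin_spec hM H).2.2.2.1 R hR
  have h3 : x ^ 3 ≤ R ^ 3 := pow_le_pow_left₀ hx.1 hx.2 3
  have hx0 := hx.1
  rw [h2, h1]
  rcases hx.1.eq_or_lt with rfl | h0
  · have : 0 < R ^ 3 * (2 * k M H R ^ 2) := by positivity
    linarith
  · have h4 : 0 < R ^ 3 * crit M H R * x ^ 3 := by positivity
    have h5 := mul_nonneg (sub_nonneg.2 h3)
      (by positivity : 0 ≤ H ^ 2 * x ^ 3 * R ^ 3 + 2 * k M H R ^ 2)
    linarith

/-- The derivative of `β` in `r` is `-r⁴ D^{-3/2}`, the derivative of `dt/dr` with respect to `c`,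
up to a term of a definite sign. -/
theorem exists_hasDerivAt_beta {M H R x : ℝ} (hM : 0 < M) (hR : R ∈ Ioo 0 (rMin M H))
    (hx : x ∈ Ico 0 R) : ∃ w ≥ 0, HasDerivAt (beta M H (k M H R))
      (-(x ^ 4 / √(disc M H (k M H R) x) ^ 3) - w) x := by
  have hD := disc_pos hM hR hx.2
  have hp := discAux_neg hM hR ⟨hx.1, hx.2.le⟩
  set c := k M H R
  have hs := Real.sqrt_pos.2 hD
  have hs2 := Real.sq_sqrt hD.le
  have h1 : HasDerivAt (discAux M H c)
      (H * (3 * x ^ 2) * (H * x ^ 3 - 2 * c) + (H * x ^ 3 + c) * (H * (3 * x ^ 2)) +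
        M * (3 * x ^ 2)) x := by
    have h3 := hasDerivAt_pow 3 x
    have := (((h3.const_mul H).add_const c).fun_mul ((h3.const_mul H).sub_const (2 * c))).fun_add
      (h3.const_mul M)
    exact this.congr_deriv (by norm_num)
  have h2 := (hasDerivAt_pow 5 x).fun_div (h1.fun_mul ((hasDerivAt_disc M H c x).sqrt hD.ne'))
    (mul_ne_zero hp.ne hs.ne')
  refine ⟨x ^ 4 * (3 * H ^ 2 * x ^ 6 + 6 * c ^ 2) /
    (discAux M H c x ^ 2 * √(disc M H c x)), by positivity, h2.congr_deriv ?_⟩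
  have hpd : x * (6 * H * x ^ 2 * (H * x ^ 3 + c) - 6 * M * x ^ 2 + 4 * x ^ 3) =
      4 * disc M H c x + 2 * discAux M H c x := by simp only [disc, discAux]; ring
  have hpp : x * (H * (3 * x ^ 2) * (H * x ^ 3 - 2 * c) + (H * x ^ 3 + c) * (H * (3 * x ^ 2)) +
        M * (3 * x ^ 2)) = 3 * discAux M H c x + (3 * H ^ 2 * x ^ 6 + 6 * c ^ 2) := by
    simp only [discAux]; ring
  generalize 6 * H * x ^ 2 * (H * x ^ 3 + c) - 6 * M * x ^ 2 + 4 * x ^ 3 = D' at *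
  generalize H * (3 * x ^ 2) * (H * x ^ 3 - 2 * c) + (H * x ^ 3 + c) * (H * (3 * x ^ 2)) +
        M * (3 * x ^ 2) = p' at *
  generalize 3 * H ^ 2 * x ^ 6 + 6 * c ^ 2 = e at *
  rw [← hs2] at hpd
  generalize √(disc M H c x) = s at *
  generalize discAux M H c x = p at *
  have hp' := hp.ne
  push_cast
  field_simp
  linear_combination (-p * x ^ 4) * hpd - 2 * s ^ 2 * x ^ 4 * hpp

/-- The derivative of the slope `-dt/dr` with respect to `c` is `r⁴ D^{-3/2}`. -/
theorem exists_hasFDerivAt_steep {M H c x : ℝ} (hD : 0 < disc M H c x) (hx : x < 2 * M) :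
    ∃ b : ℝ, HasFDerivAt (fun p : ℝ × ℝ => steep M H p.1 p.2)
      ((x ^ 4 / √(disc M H c x) ^ 3) • ContinuousLinearMap.fst ℝ ℝ ℝ +
        b • ContinuousLinearMap.snd ℝ ℝ ℝ) (c, x) := by
  have hx' : 2 * M - x ≠ 0 := (sub_pos.2 hx).ne'
  have hs := Real.sqrt_pos.2 hD
  have hs2 := Real.sq_sqrt hD.le
  have h1 : ContDiffAt ℝ 1 (fun p : ℝ × ℝ => disc M H p.1 p.2) (c, x) := by
    unfold disc; fun_prop
  have h2 : ContDiffAt ℝ 1 (fun p : ℝ × ℝ => √(disc M H p.1 p.2)) (c, x) := h1.sqrt hD.ne'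
  have h3 : HasFDerivAt (fun p : ℝ × ℝ => steep M H p.1 p.2)
      (fderiv ℝ (fun p : ℝ × ℝ => steep M H p.1 p.2) (c, x)) (c, x) := by
    refine (ContDiffAt.differentiableAt (n := 1) ?_ one_ne_zero).hasFDerivAt
    exact ContDiffAt.mul (ContDiffAt.div (by fun_prop) (by fun_prop) hx')
      (ContDiffAt.div (by fun_prop) h2 hs.ne')
  have h4 : HasDerivAt (fun c => steep M H c x) (x ^ 4 / √(disc M H c x) ^ 3) c := by
    have h5 : HasDerivAt (fun c => disc M H c x) (2 * (H * x ^ 3 + c)) c := by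
      exact ((((hasDerivAt_id c).const_add (H * x ^ 3)).fun_pow 2).sub_const
        (x ^ 3 * (2 * M - x))).congr_deriv (by simp)
    have h6 := (((hasDerivAt_id c).const_sub (-H * x ^ 3)).fun_div (h5.sqrt hD.ne')
      hs.ne').const_mul (x / (2 * M - x))
    refine h6.congr_deriv ?_
    have hDx : disc M H c x = (H * x ^ 3 + c) ^ 2 - x ^ 3 * (2 * M - x) := rfl
    rw [← hs2] at hDx
    simp only [id]
    generalize √(disc M H c x) = s at *
    generalize 2 * M - x = m at *
    field_simp
    linear_combination (-x) * hDx
  set Φ := fderiv ℝ (fun p : ℝ × ℝ => steep M H p.1 p.2) (c, x)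
  have h5 : HasDerivAt (fun y : ℝ => (y, x)) ((1 : ℝ), (0 : ℝ)) c :=
    (hasDerivAt_id c).prodMk (hasDerivAt_const c x)
  have h6 : HasDerivAt (fun c => steep M H c x) (Φ (1, 0)) c := by
    have := h3.comp_hasDerivAt c h5
    exact this
  have h7 := h6.unique h4
  refine ⟨Φ (0, 1), h3.congr_fderiv ?_⟩
  ext <;> simp [← h7, Φ]

theorem mul_one_sub_sq_mem_Ico {R σ : ℝ} (hR : 0 < R) (hσ : σ ∈ Ioc 0 1) :
    R * (1 - σ ^ 2) ∈ Ico 0 R := by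
  have h1 : σ ^ 2 ≤ 1 := by nlinarith [hσ.1, hσ.2]
  have h2 : 0 < σ ^ 2 := pow_pos hσ.1 2
  constructor <;> nlinarith

/-- Along a leaf, the derivative of `∂t/∂R` at fixed radius only involves `∂/∂c (dt/dr)`. -/
theorem hasDerivAt_fixedRadiusDeriv {M H R σ : ℝ} (hM : 0 < M) (hR : R ∈ Ioo 0 (rMin M H))
    (hσ : σ ∈ Ioc 0 1) : HasDerivAt (fixedRadiusDeriv M H R)
      (2 * R * σ * (-(R ^ 2 / qFun M R) * crit M H R *
        ((R * (1 - σ ^ 2)) ^ 4 / √(disc M H (k M H R) (R * (1 - σ ^ 2))) ^ 3))) σ := by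
  have hx := mul_one_sub_sq_mem_Ico hR.1 hσ
  have hR' := mem_Ioo_two_mul hM hR
  obtain ⟨b, hb⟩ := exists_hasFDerivAt_steep (disc_pos hM hR hx.2) (hx.2.trans hR'.2)
  have hk := hasDerivAt_k H hR'
  set a := (R * (1 - σ ^ 2)) ^ 4 / √(disc M H (k M H R) (R * (1 - σ ^ 2))) ^ 3
  set k' := -(R ^ 2 / qFun M R) * crit M H R
  -- the derivative of `speed` in `R`
  have h1 : HasDerivAt (fun R => speed M H (R, σ))
      (2 * σ * steep M H (k M H R) (R * (1 - σ ^ 2)) +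
        2 * R * σ * (a * k' + b * (1 - σ ^ 2))) R := by
    have h2 : HasDerivAt (fun R => (k M H R, R * (1 - σ ^ 2))) (k', 1 - σ ^ 2) R := by
      simpa using hk.prodMk ((hasDerivAt_id R).mul_const (1 - σ ^ 2))
    have h3 := hb.comp_hasDerivAt R h2
    have h4 : HasDerivAt (fun R => 2 * R * σ) (2 * σ) R := by
      simpa using ((hasDerivAt_id R).const_mul 2).mul_const σ
    refine ((h4.fun_mul h3).congr_deriv ?_).congr_of_eventuallyEq ?_
    · simp
    · filter_upwards [isOpen_Ioo.mem_nhds hR] with S hS using speed_eq hM hS hσ.1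
  have h2 : fderiv ℝ (speed M H) (R, σ) (1, 0) =
      2 * σ * steep M H (k M H R) (R * (1 - σ ^ 2)) +
        2 * R * σ * (a * k' + b * (1 - σ ^ 2)) := by
    have h3 : DifferentiableAt ℝ (speed M H) (R, σ) :=
      ((contDiffOn_one_speed hM H).differentiableOn one_ne_zero).differentiableAt
        ((isOpen_Ioo.prod isOpen_univ).mem_nhds ⟨hR, mem_univ _⟩)
    have h4 : HasDerivAt (fun y : ℝ => (y, σ)) ((1 : ℝ), (0 : ℝ)) R :=
      (hasDerivAt_id R).prodMk (hasDerivAt_const R σ)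
    have h6 := h3.hasFDerivAt
    have h5 : HasDerivAt (fun R => speed M H (R, σ)) (fderiv ℝ (speed M H) (R, σ) (1, 0)) R := by
      have := h6.comp_hasDerivAt R h4
      exact this
    exact h5.unique h1
  have h3 : HasDerivAt (timeDeriv M H R) (fderiv ℝ (speed M H) (R, σ) (1, 0)) σ :=
    ((continuous_timeDeriv hM hR).integral_hasStrictDerivAt 0 σ).hasDerivAt
  have h4 : HasDerivAt (fun σ : ℝ => 1 - σ ^ 2) (-(2 * σ)) σ := by
    simpa using (hasDerivAt_pow 2 σ).const_sub 1
  have h5 : HasDerivAt (fun σ => steep M H (k M H R) (R * (1 - σ ^ 2)))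
      (b * (R * -(2 * σ))) σ := by
    have := hb.comp_hasDerivAt σ ((hasDerivAt_const σ (k M H R)).prodMk (h4.const_mul R))
    refine this.congr_deriv ?_
    simp
  refine (h3.fun_add (h4.fun_mul h5)).congr_deriv ?_
  rw [h2]; ring

theorem deriv_eq_zero_of_even {n : ℝ → ℝ} (hn : ∀ x, n (-x) = n x) {d : ℝ}
    (hd : HasDerivAt n d 0) : d = 0 := by
  have h1 : HasDerivAt (fun x => n (-x)) (d * -1) 0 :=
    HasDerivAt.comp (h₂ := n) 0 (by simpa using hd) (hasDerivAt_neg 0)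
  simp only [hn] at h1
  have := hd.unique h1
  linarith

/-- At the turning point `σ = 0` the singularities of `(1 - σ²) |dt/dr|` and `k_H'(R) β` cancel,
and because `σ` times either of them is even, no constant term remains. -/
theorem tendsto_fixedRadiusDeriv_sub {M H R : ℝ} (hM : 0 < M) (hR : R ∈ Ioo 0 (rMin M H)) :
    Tendsto (fun σ => fixedRadiusDeriv M H R σ - -(R ^ 2 / qFun M R) * crit M H R *
      beta M H (k M H R) (R * (1 - σ ^ 2))) (𝓝[>] 0) (𝓝 0) := by
  have hR0 := hR.1
  have hR' := mem_Ioo_two_mul hM hR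
  have hq := qFun_pos hR'
  have hcr := (rMin_spec hM H).2.2.2.1 R hR
  have hsR := Real.sqrt_pos.2 hR0
  have hsM := Real.sqrt_pos.2 (sub_pos.2 hR'.2)
  set k' := -(R ^ 2 / qFun M R) * crit M H R with hk'
  set n : ℝ → ℝ := fun σ => (1 - σ ^ 2) * speed M H (R, σ) / (2 * R) -
    k' * ((R * (1 - σ ^ 2)) ^ 5 / (discAux M H (k M H R) (R * (1 - σ ^ 2)) *
      (R * √R * √(discQuot M H R (1 - σ ^ 2))))) with hn
  have hp0 : discAux M H (k M H R) R = -(R ^ 3 * crit M H R) := by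
    have hq := qFun_sq hR.1.le hR'.2.le
    rw [discAux, crit, k_eq H hR.1.le]
    linear_combination (-2) * hq
  have hn0 : n 0 = 0 := by
    have h2 : 0 < √(discQuot M H R 1) := by rw [discQuot_one]; positivity
    have h3 := Real.sq_sqrt hR0.le
    have h4 := Real.sq_sqrt (sub_pos.2 hR'.2).le
    have h5 : 2 * M - R ≠ 0 := (sub_pos.2 hR'.2).ne'
    simp only [hn, hk', speed, qFun]
    norm_num
    rw [hp0]
    generalize √(discQuot M H R 1) = E at *
    generalize crit M H R = Q at *
    generalize √(2 * M - R) = m at *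
    rw [← h4]
    field_simp
    rw [h3]; ring
  have hnd : DifferentiableAt ℝ n 0 := by
    have h1 : DifferentiableAt ℝ (fun σ => speed M H (R, σ)) 0 := by
      have h3 : DifferentiableAt ℝ (speed M H) (R, 0) :=
        ((contDiffOn_one_speed hM H).differentiableOn one_ne_zero).differentiableAt
          ((isOpen_Ioo.prod isOpen_univ).mem_nhds ⟨hR, mem_univ _⟩)
      exact h3.comp (0 : ℝ) (f := fun σ : ℝ => (R, σ)) (by fun_prop)
    have h2 : DifferentiableAt ℝ (fun σ : ℝ => √(discQuot M H R (1 - σ ^ 2))) 0 := by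
      refine DifferentiableAt.sqrt (by unfold discQuot; fun_prop) ?_
      norm_num
      rw [discQuot_one]; positivity
    have h3 : DifferentiableAt ℝ (fun σ : ℝ => discAux M H (k M H R) (R * (1 - σ ^ 2))) 0 := by
      unfold discAux; fun_prop
    refine ((DifferentiableAt.fun_mul (by fun_prop) h1).div_const _).fun_sub
      ((DifferentiableAt.fun_div (by fun_prop) (h3.fun_mul (h2.const_mul _)) ?_).const_mul _)
    norm_num
    rw [hp0, discQuot_one]
    exact ⟨neg_ne_zero.2 (by positivity), ⟨hR0.ne', hsR.ne'⟩, by positivity⟩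
  have hneven : ∀ σ, n (-σ) = n σ := fun σ => by simp [hn, speed]
  have hnd0 : HasDerivAt n 0 0 := by
    have := hnd.hasDerivAt
    rwa [deriv_eq_zero_of_even hneven this] at this
  have h1 : Tendsto (fun σ => n σ / σ) (𝓝[>] 0) (𝓝 0) := by
    have := (hasDerivAt_iff_tendsto_slope_zero.1 hnd0).mono_left
      (nhdsWithin_mono 0 (fun x hx => ne_of_gt hx : Ioi (0 : ℝ) ⊆ {0}ᶜ))
    simpa [hn0, div_eq_inv_mul] using this
  have h2 : Tendsto (timeDeriv M H R) (𝓝[>] 0) (𝓝 0) := by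
    have h3 : HasDerivAt (timeDeriv M H R) _ 0 :=
      ((continuous_timeDeriv hM hR).integral_hasStrictDerivAt 0 0).hasDerivAt
    have := h3.continuousAt.tendsto.mono_left (nhdsWithin_le_nhds (s := Ioi 0))
    simpa [timeDeriv] using this
  have h3 := h2.add h1
  rw [add_zero] at h3
  refine h3.congr' ?_
  filter_upwards [self_mem_nhdsWithin] with σ hσ
  have hσ' : (0 : ℝ) < σ := hσ
  simp only [hn, fixedRadiusDeriv, beta]
  rw [speed_eq hM hR hσ', sqrt_disc hM hR hσ'.le]
  field_simp
  ring

/-- A lower bound for `∂t/∂R` at fixed radius, which is positive for `0 < σ < 1`: the difference of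
the two sides is monotone in `σ` and tends to `0` at the turning point. -/
theorem mul_beta_le_fixedRadiusDeriv {M H R σ : ℝ} (hM : 0 < M) (hR : R ∈ Ioo 0 (rMin M H))
    (hσ : σ ∈ Ioc 0 1) : -(R ^ 2 / qFun M R) * crit M H R *
      beta M H (k M H R) (R * (1 - σ ^ 2)) ≤ fixedRadiusDeriv M H R σ := by
  have hlim := tendsto_fixedRadiusDeriv_sub hM hR
  have hR0 := hR.1
  have hq := qFun_pos (mem_Ioo_two_mul hM hR)
  have hcr := (rMin_spec hM H).2.2.2.1 R hR
  have key : ∀ σ ∈ Ioc (0 : ℝ) 1, ∃ d ≥ 0, HasDerivAt (fun σ => fixedRadiusDeriv M H R σ -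
      -(R ^ 2 / qFun M R) * crit M H R * beta M H (k M H R) (R * (1 - σ ^ 2))) d σ := by
    intro σ hσ
    obtain ⟨w, hw, h1⟩ := exists_hasDerivAt_beta hM hR (mul_one_sub_sq_mem_Ico hR0 hσ)
    have h4 : HasDerivAt (fun σ : ℝ => R * (1 - σ ^ 2)) (R * -(2 * σ)) σ := by
      simpa using ((hasDerivAt_pow 2 σ).const_sub 1).const_mul R
    have h5 := (hasDerivAt_fixedRadiusDeriv hM hR hσ).fun_sub
      ((h1.comp σ h4).const_mul (-(R ^ 2 / qFun M R) * crit M H R))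
    have hσ0 := hσ.1
    refine ⟨2 * R * σ * (R ^ 2 / qFun M R * crit M H R) * w, by positivity, h5.congr_deriv ?_⟩
    ring
  have hmono : MonotoneOn (fun σ => fixedRadiusDeriv M H R σ -
      -(R ^ 2 / qFun M R) * crit M H R * beta M H (k M H R) (R * (1 - σ ^ 2))) (Ioc 0 1) := by
    refine monotoneOn_of_deriv_nonneg (convex_Ioc 0 1) (fun σ hσ => ?_) (fun σ hσ => ?_)
      fun σ hσ => ?_
    · obtain ⟨d, -, h⟩ := key σ hσ
      exact h.continuousAt.continuousWithinAt
    · obtain ⟨d, -, h⟩ := key σ (interior_subset hσ)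
      exact h.differentiableAt.differentiableWithinAt
    · obtain ⟨d, hd, h⟩ := key σ (interior_subset hσ)
      rwa [h.deriv]
  rw [← sub_nonneg]
  refine le_of_tendsto hlim ?_
  filter_upwards [Ioc_mem_nhdsGT hσ.1] with s hs
  exact hmono ⟨hs.1, hs.2.trans hσ.2⟩ hσ hs.2

theorem fixedRadiusDeriv_pos {M H R σ : ℝ} (hM : 0 < M) (hR : R ∈ Ioo 0 (rMin M H))
    (hσ : σ ∈ Ioo 0 1) : 0 < fixedRadiusDeriv M H R σ := by
  refine lt_of_lt_of_le ?_ (mul_beta_le_fixedRadiusDeriv hM hR ⟨hσ.1, hσ.2.le⟩)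
  have hR0 := hR.1
  have hx := mul_one_sub_sq_mem hR0 hσ
  refine mul_pos_of_neg_of_neg ?_ ?_
  · rw [neg_mul, neg_lt_zero]
    exact mul_pos (div_pos (by positivity) (qFun_pos (mem_Ioo_two_mul hM hR)))
      ((rMin_spec hM H).2.2.2.1 R hR)
  · exact div_neg_of_pos_of_neg (pow_pos hx.1 5) (mul_neg_of_neg_of_pos
      (discAux_neg hM hR (Ioo_subset_Icc_self hx)) (Real.sqrt_pos.2 (disc_pos hM hR hx.2)))

/-- The radius `r = 0`, that is `σ = 1`, where the function `β` vanishes. -/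
theorem timeDeriv_one_nonneg {M H R : ℝ} (hM : 0 < M) (hR : R ∈ Ioo 0 (rMin M H)) :
    0 ≤ timeDeriv M H R 1 := by
  have := mul_beta_le_fixedRadiusDeriv hM hR (σ := 1) ⟨one_pos, le_rfl⟩
  simpa [fixedRadiusDeriv, beta] using this

theorem speed_zero_pos {M H R : ℝ} (hM : 0 < M) (hR : R ∈ Ioo 0 (rMin M H)) :
    0 < speed M H (R, 0) := by
  have hR0 := hR.1
  have h2 := sub_pos.2 (mem_Ioo_two_mul hM hR).2
  have h1 := Real.sqrt_pos.2 (discQuot_pos hM (Ioo_subset_Ico_self hR) le_rfl)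
  simp only [speed]
  norm_num
  positivity

/-- The Jacobian determinant of `(R, σ) ↦ (t, r)`, up to sign. -/
theorem jacobian_pos {M H R σ : ℝ} (hM : 0 < M) (hR : R ∈ Ioo 0 (rMin M H))
    (hσ : σ ∈ Ioo (-1) 1) :
    0 < (1 - σ ^ 2) * speed M H (R, σ) + 2 * R * σ * timeDeriv M H R σ := by
  have hR0 := hR.1
  have key : ∀ σ ∈ Ioo (0 : ℝ) 1,
      0 < (1 - σ ^ 2) * speed M H (R, σ) + 2 * R * σ * timeDeriv M H R σ := fun σ hσ => by
    have h1 := fixedRadiusDeriv_pos hM hR hσ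
    have hσ0 := hσ.1
    have h2 : 0 < 2 * R * σ * fixedRadiusDeriv M H R σ := by positivity
    rw [speed_eq hM hR hσ.1]
    rw [fixedRadiusDeriv] at h2
    linarith
  rcases lt_trichotomy σ 0 with h | rfl | h
  · have h1 := key (-σ) ⟨by linarith, by linarith [hσ.1]⟩
    rw [timeDeriv_neg hM hR] at h1
    have h2 : speed M H (R, -σ) = speed M H (R, σ) := by simp [speed]
    rw [h2] at h1
    linarith
  · simpa using speed_zero_pos hM hR
  · exact key σ ⟨h, hσ.2⟩

/-- At fixed radius `r`, the time coordinate of the half `t ≥ 0` of the leaf is a strictly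
increasing function of the radius `R` of the turning point. -/
theorem strictMonoOn_time {M H r : ℝ} (hM : 0 < M) (hr : r ∈ Ioo 0 (rMin M H)) :
    StrictMonoOn (fun R => time M H R √(1 - r / R)) (Ico r (rMin M H)) := by
  have hsub : ∀ R ∈ Ico r (rMin M H), R ∈ Ioo 0 (rMin M H) := fun R hR =>
    ⟨hr.1.trans_le hR.1, hR.2⟩
  refine strictMonoOn_of_deriv_pos (convex_Ico _ _) ?_ fun R hR => ?_
  · refine (contDiffOn_time hM H).continuousOn.comp (f := fun R => (R, √(1 - r / R)))
      (ContinuousOn.prodMk continuousOn_id (ContinuousOn.sqrt (continuousOn_const.sub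
        (continuousOn_const.div continuousOn_id fun R hR => (hsub R hR).1.ne'))))
      fun R hR => ⟨hsub R hR, mem_univ _⟩
  · rw [interior_Ico] at hR
    have hR' := hsub R (Ioo_subset_Ico_self hR)
    have hR0 := hR'.1
    have h1 := sqrt_one_sub_div_mem ⟨hr.1, hR.1⟩
    have h2 : HasDerivAt (fun R => 1 - r / R) (r / R ^ 2) R := by
      have := ((hasDerivAt_inv hR0.ne').const_mul r).const_sub 1
      refine this.congr_deriv ?_
      ring
    have h3 := (hasFDerivAt_time hM hR' √(1 - r / R)).comp_hasDerivAt R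
      ((hasDerivAt_id R).prodMk (h2.sqrt (Real.sqrt_pos.1 h1.1).ne'))
    have h4 := fixedRadiusDeriv_pos hM hR' h1
    refine lt_of_lt_of_eq h4 (Eq.trans ?_ h3.deriv.symm)
    simp only [add_apply, smul_apply, smul_eq_mul,
      ContinuousLinearMap.coe_fst', ContinuousLinearMap.coe_snd', mul_one]
    rw [fixedRadiusDeriv, speed_eq hM hR' h1.1]
    have h5 : 1 - √(1 - r / R) ^ 2 = r / R := by
      rw [Real.sq_sqrt (Real.sqrt_pos.1 h1.1).le]; ring
    rw [h5]
    have := h1.1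
    generalize √(1 - r / R) = s at this ⊢
    field_simp

/-! ### Limits of the height function -/

theorem speed_pos {M H R σ : ℝ} (hM : 0 < M) (hR : R ∈ Ioo 0 (rMin M H))
    (hσ : σ ∈ Ioo (-1) 1) : 0 < speed M H (R, σ) := by
  have hR0 := hR.1
  have key : ∀ σ ∈ Ioo (0 : ℝ) 1, 0 < speed M H (R, σ) := fun σ hσ => by
    rw [speed_eq hM hR hσ.1]
    exact mul_pos (mul_pos (by positivity) hσ.1) (steep_pos hM hR (mul_one_sub_sq_mem hR0 hσ))
  rcases lt_trichotomy σ 0 with h | rfl | h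
  · have h1 := key (-σ) ⟨by linarith, by linarith [hσ.1]⟩
    simpa [speed] using h1
  · exact speed_zero_pos hM hR
  · exact key σ ⟨h, hσ.2⟩

theorem continuous_time {M H R : ℝ} (hM : 0 < M) (hR : R ∈ Ioo 0 (rMin M H)) :
    Continuous (time M H R) :=
  continuous_iff_continuousAt.2 fun σ => (hasDerivAt_time hM hR σ).continuousAt

theorem strictMonoOn_time_right {M H R : ℝ} (hM : 0 < M) (hR : R ∈ Ioo 0 (rMin M H)) :
    StrictMonoOn (time M H R) (Icc (-1) 1) := by
  refine strictMonoOn_of_deriv_pos (convex_Icc _ _) (continuous_time hM hR).continuousOn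
    fun σ hσ => ?_
  rw [interior_Icc] at hσ
  rw [(hasDerivAt_time hM hR σ).deriv]
  exact speed_pos hM hR hσ

theorem tendsto_time_one_zero {M : ℝ} (hM : 0 < M) (H : ℝ) :
    Tendsto (fun R => time M H R 1) (𝓝[>] 0) (𝓝 0) := by
  have h0 := (rMin_spec hM H).1.1
  have h1 : ContinuousOn (fun R => time M H R 1) (Ico 0 (rMin M H)) :=
    (continuousOn_time hM H).comp (f := fun R => (R, (1 : ℝ))) (by fun_prop)
      fun R hR => ⟨hR, mem_univ _⟩
  have h2 : time M H 0 1 = 0 := by simp [time, speed]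
  have h3 := (h1 0 ⟨le_rfl, h0⟩).tendsto
  rw [h2] at h3
  refine h3.mono_left ?_
  rw [← nhdsWithin_Ioo_eq_nhdsGT h0]
  exact nhdsWithin_mono 0 Ioo_subset_Ico_self

/-- At `R = r_H` the factor `D(R y) / (R³ (1 - y))` vanishes at `y = 1`: the root of `D` is
a double root. -/
theorem discQuot_rMin_le {M y : ℝ} (hM : 0 < M) (H : ℝ) (h0 : 0 ≤ y) (h1 : y ≤ 1) :
    discQuot M H (rMin M H) y ≤
      (1 - y) * (9 * H ^ 2 * rMin M H ^ 3 + 2 * rMin M H) := by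
  have hc : crit M H (rMin M H) = 0 := (rMin_spec hM H).2.2.1
  have hR := (rMin_spec hM H).1.1
  generalize rMin M H = R at hc hR ⊢
  have h2 : discQuot M H R y = (1 - y) * (H ^ 2 * R ^ 3 * (y ^ 2 + y + 1) ^ 2 +
      R * (3 * y ^ 2 + 2 * y + 1) / 3) := by
    rw [crit] at hc
    rw [discQuot]
    linear_combination (2 / 3 * (y ^ 2 + y + 1)) * hc
  rw [h2]
  have hy2 : y ^ 2 ≤ 1 := by nlinarith
  have h3 : (y ^ 2 + y + 1) ^ 2 ≤ 3 ^ 2 := pow_le_pow_left₀ (by positivity) (by linarith) 2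
  have h4 : H ^ 2 * R ^ 3 * (y ^ 2 + y + 1) ^ 2 ≤ H ^ 2 * R ^ 3 * 3 ^ 2 := by gcongr
  have h5 : R * (3 * y ^ 2 + 2 * y + 1) ≤ R * 6 := by gcongr; linarith
  refine mul_le_mul_of_nonneg_left ?_ (by linarith)
  linarith

/-- A bound for `D` that holds for all leaves, because `D` decreases with `c` before the turning
point is reached; the bound comes from the double root for `R = r_H`. -/
theorem disc_le {M H R x : ℝ} (hM : 0 < M) (hR : R ∈ Ioo 0 (rMin M H)) (hx : x ∈ Ioo 0 R) :
    disc M H (k M H R) x ≤ (rMin M H * (9 * H ^ 2 * rMin M H ^ 3 + 2 * rMin M H)) *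
      (rMin M H - x) ^ 2 := by
  obtain ⟨hm, hm', -⟩ := rMin_spec hM H
  have hx2 : x < 2 * M := hx.2.trans (mem_Ioo_two_mul hM hR).2
  have h1 : disc M H (k M H R) x ≤ disc M H (k M H (rMin M H)) x := by
    have h2 := qFun_lt hM hR hx
    have h3 := qFun_pos ⟨hx.1, hx2⟩
    have h4 := (k_mem_Ioo hM hR).1
    rw [← hm'] at h4
    simp only [disc]
    nlinarith
  refine h1.trans ?_
  have hm0 := hm.1
  have hy1 : x / rMin M H ≤ 1 := (div_le_one hm0).2 (hx.2.trans hR.2).le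
  have h5 := disc_mul H hm.1.le hm.2.le (x / rMin M H)
  have h6 := discQuot_rMin_le hM H (div_pos hx.1 hm0).le hy1
  rw [mul_div_cancel₀ _ hm0.ne'] at h5
  rw [h5]
  calc rMin M H ^ 3 * (1 - x / rMin M H) * discQuot M H (rMin M H) (x / rMin M H)
      ≤ rMin M H ^ 3 * (1 - x / rMin M H) * ((1 - x / rMin M H) *
        (9 * H ^ 2 * rMin M H ^ 3 + 2 * rMin M H)) :=
        mul_le_mul_of_nonneg_left h6 (mul_nonneg (by positivity) (by linarith))
    _ = _ := by field_simp

/-- The slope `-dt/dr` blows up like `1 / (r_H - r)`, uniformly in the leaf. -/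
theorem exists_le_steep {M H r : ℝ} (hM : 0 < M) (hr : r ∈ Ioo 0 (rMin M H)) :
    ∃ κ > 0, ∀ R ∈ Ioo r (rMin M H), ∀ x ∈ Ioo r R,
      κ / (rMin M H - x) ≤ steep M H (k M H R) x := by
  obtain ⟨hm, -⟩ := rMin_spec hM H
  set m := rMin M H with hmdef
  have hr0 := hr.1
  have hm0 := hm.1
  have hsr := Real.sqrt_pos.2 hr0
  have hsm := Real.sqrt_pos.2 (sub_pos.2 hm.2)
  set B := m * (9 * H ^ 2 * m ^ 3 + 2 * m) with hB
  have hB0 : 0 < B := by positivity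
  have hsB := Real.sqrt_pos.2 hB0
  refine ⟨r / (2 * M) * (r * √r * √(2 * M - m) / √B), by positivity, fun R hR x hx => ?_⟩
  have hR' : R ∈ Ioo 0 m := ⟨hr0.trans hR.1, hR.2⟩
  have hx' : x ∈ Ioo 0 R := ⟨hr0.trans hx.1, hx.2⟩
  have hx0 := hx'.1
  have hmx : 0 < m - x := by linarith [hx.2, hR.2]
  have h2x : 0 < 2 * M - x := by linarith [hm.2]
  have h1 := qFun_lt hM hR' hx'
  have h2 : r * √r * √(2 * M - m) ≤ -H * x ^ 3 - k M H R := by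
    refine le_trans ?_ h1.le
    unfold qFun
    have := hx.1.le
    gcongr
    linarith [hm.2]
  have h3 : √(disc M H (k M H R) x) ≤ √B * (m - x) := by
    rw [← Real.sqrt_sq hmx.le, ← Real.sqrt_mul hB0.le]
    exact Real.sqrt_le_sqrt (disc_le hM hR' hx')
  have hD := Real.sqrt_pos.2 (disc_pos hM hR' hx'.2)
  calc r / (2 * M) * (r * √r * √(2 * M - m) / √B) / (m - x)
      = r / (2 * M) * (r * √r * √(2 * M - m) / (√B * (m - x))) := by field_simp
    _ ≤ x / (2 * M - x) * ((-H * x ^ 3 - k M H R) / √(disc M H (k M H R) x)) := by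
        have h4 : 0 ≤ r * √r * √(2 * M - m) := by positivity
        have h5 : r / (2 * M) ≤ x / (2 * M - x) :=
          div_le_div₀ hx0.le hx.1.le h2x (by linarith)
        have h6 := div_le_div₀ (h4.trans h2) h2 hD h3
        exact mul_le_mul h5 h6 (by positivity) (by positivity)

/-- At fixed radius `r` the time coordinate of the leaf tends to infinity as `R → r_H`, by
comparison with `log ((r_H - r) / (r_H - R))`. -/
theorem tendsto_time_rMin {M H r : ℝ} (hM : 0 < M) (hr : r ∈ Ioo 0 (rMin M H)) :
    Tendsto (fun R => time M H R √(1 - r / R)) (𝓝[<] (rMin M H)) atTop := by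
  obtain ⟨κ, hκ, hle⟩ := exists_le_steep hM hr
  set m := rMin M H with hm
  have h1 : Tendsto (fun R => κ * Real.log (m - r) + κ * -Real.log (m - R)) (𝓝[<] m) atTop := by
    refine tendsto_atTop_add_const_left _ _ (Tendsto.const_mul_atTop hκ ?_)
    refine tendsto_neg_atBot_atTop.comp (Real.tendsto_log_nhdsGT_zero.comp ?_)
    refine tendsto_nhdsWithin_iff.2 ⟨?_, ?_⟩
    · have : Tendsto (fun R => m - R) (𝓝 m) (𝓝 (m - m)) := tendsto_const_nhds.sub tendsto_id
      rw [sub_self] at this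
      exact this.mono_left nhdsWithin_le_nhds
    · filter_upwards [self_mem_nhdsWithin] with R hR using sub_pos.2 (show R < m from hR)
  refine tendsto_atTop_mono' _ ?_ h1
  filter_upwards [Ioo_mem_nhdsLT hr.2] with R hR
  have hR' : R ∈ Ioo 0 m := ⟨hr.1.trans hR.1, hR.2⟩
  have hanti : AntitoneOn (fun x => time M H R √(1 - x / R) - κ * Real.log (m - x)) (Icc r R) := by
    have hne : ∀ x ∈ Icc r R, m - x ≠ 0 := fun x hx => (sub_pos.2 (hx.2.trans_lt hR.2)).ne'
    have hder : ∀ x ∈ Ioo r R, HasDerivAt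
        (fun x => time M H R √(1 - x / R) - κ * Real.log (m - x))
        (slope M H (k M H R) x - κ * (-1 / (m - x))) x := fun x hx =>
      (hasDerivAt_time_sqrt hM hR' ⟨hr.1.trans hx.1, hx.2⟩).fun_sub
        ((((hasDerivAt_id x).const_sub m).log (hne x (Ioo_subset_Icc_self hx))).const_mul κ)
    refine antitoneOn_of_deriv_nonpos (convex_Icc _ _) ?_ ?_ ?_
    · refine ContinuousOn.sub (continuous_time_sqrt hM hR').continuousOn
        (continuousOn_const.mul (ContinuousOn.log (by fun_prop) hne))
    · rw [interior_Icc]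
      exact fun x hx => (hder x hx).differentiableAt.differentiableWithinAt
    · rw [interior_Icc]
      intro x hx
      rw [(hder x hx).deriv, slope_eq hM hR' ⟨hr.1.trans hx.1, hx.2⟩]
      have := hle R hR x hx
      have h2 : κ * (-1 / (m - x)) = -(κ / (m - x)) := by ring
      rw [h2]; linarith
  have h2 := hanti ⟨le_rfl, hR.1.le⟩ ⟨hR.1.le, le_rfl⟩ hR.1.le
  simp only [div_self hR'.1.ne', sub_self, Real.sqrt_zero, time_zero] at h2
  linarith

theorem tendsto_time_one_rMin {M : ℝ} (hM : 0 < M) (H : ℝ) :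
    Tendsto (fun R => time M H R 1) (𝓝[<] (rMin M H)) atTop := by
  have h0 := (rMin_spec hM H).1.1
  have hr : rMin M H / 2 ∈ Ioo 0 (rMin M H) := ⟨by linarith, by linarith⟩
  refine tendsto_atTop_mono' _ ?_ (tendsto_time_rMin hM hr)
  filter_upwards [Ioo_mem_nhdsLT hr.2] with R hR
  have h1 := sqrt_one_sub_div_mem ⟨hr.1, hR.1⟩
  exact (strictMonoOn_time_right hM ⟨hr.1.trans hR.1, hR.2⟩).monotoneOn
    ⟨by linarith [h1.1], h1.2.le⟩ ⟨by norm_num, le_rfl⟩ h1.2.le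

theorem height_zero {M H R : ℝ} (hM : 0 < M) (hR : R ∈ Ioo 0 (rMin M H)) :
    height M H (k M H R) 0 = time M H R 1 := by
  rw [height_eq hM hR ⟨le_rfl, hR.1.le⟩]; simp

theorem height_rMinus {M H c : ℝ} (hM : 0 < M) (hc : c ∈ Ioo (cMin M H) 0) :
    height M H c 0 = time M H (rMinus M H c) 1 := by
  rw [← height_zero hM (rMinus_mem hM hc), k_rMinus hM hc]

theorem tendsto_height_cMin {M : ℝ} (hM : 0 < M) (H : ℝ) :
    Tendsto (fun c => height M H c 0) (𝓝[>] (cMin M H)) atTop := by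
  refine ((tendsto_time_one_rMin hM H).comp (tendsto_rMinus_cMin hM H)).congr' ?_
  filter_upwards [Ioo_mem_nhdsGT (cMin_neg hM H)] with c hc using (height_rMinus hM hc).symm

theorem tendsto_height_zero {M : ℝ} (hM : 0 < M) (H : ℝ) :
    Tendsto (fun c => height M H c 0) (𝓝[<] 0) (𝓝 0) := by
  refine ((tendsto_time_one_zero hM H).comp (tendsto_rMinus_zero hM H)).congr' ?_
  filter_upwards [Ioo_mem_nhdsLT (cMin_neg hM H)] with c hc using (height_rMinus hM hc).symm

theorem exists_hasDerivAt_log_coordV {M H c : ℝ} (hM : 0 < M) (hc : c ∈ Ioo (cMin M H) 0) :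
    ∃ d ≤ (0 : ℝ), HasDerivAt (fun c' => Real.log (coordV M (height M H c' 0) 0)) d c := by
  obtain ⟨d, hd, h1⟩ := hasDerivAt_rMinus hM hc
  have hR := rMinus_mem hM hc
  have h2 := (hasDerivAt_time_left hM hR 1).comp c h1
  have h3 := (h2.add_const (0 + 2 * M * Real.log |0 - 2 * M|)).div_const (4 * M)
  refine ⟨timeDeriv M H (rMinus M H c) 1 * d / (4 * M), ?_, h3.congr_of_eventuallyEq ?_⟩
  · exact div_nonpos_of_nonpos_of_nonneg
      (mul_nonpos_of_nonneg_of_nonpos (timeDeriv_one_nonneg hM hR) hd.le) (by positivity)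
  · filter_upwards [isOpen_Ioo.mem_nhds hc] with c' hc'
    rw [coordV, Real.log_exp, height_rMinus hM hc']
    rfl

/-! ### The area radius and the Schwarzschild coordinates of region II -/

/-- The function `r ↦ (r - 2M) exp(r / 2M) = UV`, the inverse of `areaRadius`. -/
noncomputable def radiusProd (M r : ℝ) : ℝ := (r - 2 * M) * Real.exp (r / (2 * M))

/-- The tortoise coordinate `r + 2M log |r - 2M|`. -/
noncomputable def tortoise (M r : ℝ) : ℝ := r + 2 * M * Real.log |r - 2 * M|

theorem hasDerivAt_radiusProd {M : ℝ} (hM : 0 < M) (r : ℝ) :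
    HasDerivAt (radiusProd M) (r / (2 * M) * Real.exp (r / (2 * M))) r := by
  have h1 := ((hasDerivAt_id r).sub_const (2 * M)).fun_mul
    (((hasDerivAt_id r).div_const (2 * M)).exp)
  refine h1.congr_deriv ?_
  simp only [id]
  field_simp; ring

theorem strictMonoOn_radiusProd {M : ℝ} (hM : 0 < M) : StrictMonoOn (radiusProd M) (Ici 0) := by
  refine strictMonoOn_of_deriv_pos (convex_Ici 0)
    (fun r _ => (hasDerivAt_radiusProd hM r).continuousAt.continuousWithinAt) fun r hr => ?_
  rw [interior_Ici] at hr
  have hr' : 0 < r := hr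
  rw [(hasDerivAt_radiusProd hM r).deriv]
  positivity

theorem exists_radiusProd_eq {M w : ℝ} (hM : 0 < M) (hw : -2 * M < w) :
    ∃ r ∈ Ioi 0, radiusProd M r = w := by
  have h0 : radiusProd M 0 = -2 * M := by simp [radiusProd]
  -- at `r = 2M + |w| + 1` the exponential is at least `1`
  have h1 : w < radiusProd M (2 * M + |w| + 1) := by
    have h2 : 1 ≤ Real.exp ((2 * M + |w| + 1) / (2 * M)) := Real.one_le_exp (by positivity)
    have h3 := le_abs_self w
    have h4 : 0 ≤ |w| := abs_nonneg w
    simp only [radiusProd]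
    nlinarith
  obtain ⟨r, hr, hr'⟩ := intermediate_value_Ioo (by positivity : (0 : ℝ) ≤ 2 * M + |w| + 1)
    (fun r _ => (hasDerivAt_radiusProd hM r).continuousAt.continuousWithinAt)
    (show w ∈ Ioo (radiusProd M 0) (radiusProd M (2 * M + |w| + 1)) from ⟨h0 ▸ hw, h1⟩)
  exact ⟨r, hr.1, hr'⟩

theorem areaRadius_pos {M w : ℝ} (hM : 0 < M) (hw : -2 * M < w) : 0 < areaRadius M w :=
  Function.invFunOn_mem (exists_radiusProd_eq hM hw)

theorem radiusProd_areaRadius {M w : ℝ} (hM : 0 < M) (hw : -2 * M < w) :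
    radiusProd M (areaRadius M w) = w :=
  Function.invFunOn_eq (exists_radiusProd_eq hM hw)

theorem neg_two_mul_lt_radiusProd {M r : ℝ} (hM : 0 < M) (hr : 0 < r) :
    -2 * M < radiusProd M r := by
  have := strictMonoOn_radiusProd hM self_mem_Ici hr.le hr
  simpa [radiusProd] using this

theorem areaRadius_radiusProd {M r : ℝ} (hM : 0 < M) (hr : 0 < r) :
    areaRadius M (radiusProd M r) = r := by
  have hw := neg_two_mul_lt_radiusProd hM hr
  exact (strictMonoOn_radiusProd hM).injOn (areaRadius_pos hM hw).le hr.le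
    (radiusProd_areaRadius hM hw)

theorem areaRadius_lt_iff {M r w : ℝ} (hM : 0 < M) (hw : -2 * M < w) (hr : 0 < r) :
    areaRadius M w < r ↔ w < radiusProd M r := by
  rw [← (strictMonoOn_radiusProd hM).lt_iff_lt (areaRadius_pos hM hw).le hr.le,
    radiusProd_areaRadius hM hw]

theorem lt_areaRadius_iff {M r w : ℝ} (hM : 0 < M) (hw : -2 * M < w) (hr : 0 < r) :
    r < areaRadius M w ↔ radiusProd M r < w := by
  rw [← (strictMonoOn_radiusProd hM).lt_iff_lt hr.le (areaRadius_pos hM hw).le,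
    radiusProd_areaRadius hM hw]

theorem continuousAt_areaRadius {M w : ℝ} (hM : 0 < M) (hw : -2 * M < w) :
    ContinuousAt (areaRadius M) w := by
  have hI : ∀ᶠ w in 𝓝 w, -2 * M < w := lt_mem_nhds hw
  refine tendsto_order.2 ⟨fun a ha => ?_, fun a ha => ?_⟩
  · obtain ⟨b, hb1, hb2⟩ := exists_between (max_lt ha (areaRadius_pos hM hw))
    have hb : 0 < b := (le_max_right _ _).trans_lt hb1
    filter_upwards [hI, lt_mem_nhds ((lt_areaRadius_iff hM hw hb).1 hb2)] with x hx hx'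
    exact ((le_max_left _ _).trans_lt hb1).trans ((lt_areaRadius_iff hM hx hb).2 hx')
  · have hb : 0 < a := (areaRadius_pos hM hw).trans ha
    filter_upwards [hI, gt_mem_nhds ((areaRadius_lt_iff hM hw hb).1 ha)] with x hx hx'
    exact (areaRadius_lt_iff hM hx hb).2 hx'

theorem hasDerivAt_areaRadius {M w : ℝ} (hM : 0 < M) (hw : -2 * M < w) :
    HasDerivAt (areaRadius M)
      (2 * M * Real.exp (-areaRadius M w / (2 * M)) / areaRadius M w) w := by
  have h0 := areaRadius_pos hM hw
  have h1 := HasDerivAt.of_local_left_inverse (continuousAt_areaRadius hM hw)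
    (hasDerivAt_radiusProd hM (areaRadius M w)) (by positivity) (by
      filter_upwards [lt_mem_nhds hw] with x hx using radiusProd_areaRadius hM hx)
  refine h1.congr_deriv ?_
  rw [neg_div, Real.exp_neg]
  field_simp

theorem coordU_eq (M t r : ℝ) : coordU M t r = -Real.exp (-(t - tortoise M r) / (4 * M)) := rfl

theorem coordV_eq (M t r : ℝ) : coordV M t r = Real.exp ((t + tortoise M r) / (4 * M)) := rfl

theorem coordU_neg (M t r : ℝ) : coordU M t r < 0 := neg_lt_zero.2 (Real.exp_pos _)

theorem coordV_pos (M t r : ℝ) : 0 < coordV M t r := Real.exp_pos _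

theorem coordU_mul_coordV {M t r : ℝ} (hM : 0 < M) (hr : r ∈ Ioo 0 (2 * M)) :
    coordU M t r * coordV M t r = radiusProd M r := by
  rw [coordU_eq, coordV_eq, neg_mul, ← Real.exp_add, tortoise,
    show -(t - (r + 2 * M * Real.log |r - 2 * M|)) / (4 * M) +
      (t + (r + 2 * M * Real.log |r - 2 * M|)) / (4 * M) =
      Real.log |r - 2 * M| + r / (2 * M) by field_simp; ring,
    Real.exp_add, Real.exp_log (abs_pos.2 (sub_neg.2 hr.2).ne), abs_of_neg (sub_neg.2 hr.2),
    radiusProd]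
  ring

theorem areaRadius_coord {M t r : ℝ} (hM : 0 < M) (hr : r ∈ Ioo 0 (2 * M)) :
    areaRadius M (coordU M t r * coordV M t r) = r := by
  rw [coordU_mul_coordV hM hr, areaRadius_radiusProd hM hr.1]

theorem coord_mem_regionII {M t r : ℝ} (hM : 0 < M) (hr : r ∈ Ioo 0 (2 * M)) :
    (coordU M t r, coordV M t r) ∈ regionII M := by
  refine ⟨?_, coordU_neg M t r, coordV_pos M t r⟩
  change -2 * M < coordU M t r * coordV M t r
  rw [coordU_mul_coordV hM hr]
  exact neg_two_mul_lt_radiusProd hM hr.1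

theorem coord_injective {M t r t' r' : ℝ} (hM : 0 < M) (hr : r ∈ Ioo 0 (2 * M))
    (hr' : r' ∈ Ioo 0 (2 * M))
    (h : ((coordU M t r, coordV M t r) : ℝ × ℝ) = (coordU M t' r', coordV M t' r')) :
    t = t' ∧ r = r' := by
  obtain ⟨h1, h2⟩ := Prod.mk.inj h
  have h3 := areaRadius_coord (t := t) hM hr
  rw [h1, h2, areaRadius_coord hM hr'] at h3
  subst h3
  refine ⟨?_, rfl⟩
  rw [coordV_eq, coordV_eq, Real.exp_eq_exp, div_left_inj' (by positivity)] at h2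
  linarith

theorem exists_coord_eq {M : ℝ} (hM : 0 < M) {p : ℝ × ℝ} (hp : p ∈ regionII M) :
    ∃ t, ∃ r ∈ Ioo 0 (2 * M), p = (coordU M t r, coordV M t r) := by
  obtain ⟨hw, hU, hV⟩ := hp
  have hr : areaRadius M (p.1 * p.2) ∈ Ioo 0 (2 * M) := by
    refine ⟨areaRadius_pos hM hw, (areaRadius_lt_iff hM hw (by positivity)).2 ?_⟩
    simpa [radiusProd] using mul_neg_of_neg_of_pos hU hV
  set r := areaRadius M (p.1 * p.2) with hrdef
  refine ⟨4 * M * Real.log p.2 - tortoise M r, r, hr, ?_⟩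
  have h1 : coordV M (4 * M * Real.log p.2 - tortoise M r) r = p.2 := by
    rw [coordV_eq, show (4 * M * Real.log p.2 - tortoise M r + tortoise M r) / (4 * M) =
      Real.log p.2 by field_simp; ring, Real.exp_log hV]
  have h2 := coordU_mul_coordV (t := 4 * M * Real.log p.2 - tortoise M r) hM hr
  rw [h1, hrdef, radiusProd_areaRadius hM hw, ← hrdef] at h2
  exact Prod.ext (mul_right_cancel₀ hV.ne' h2).symm h1.symm

theorem coord_mem_innerRegion_iff {M H t r : ℝ} (hM : 0 < M) (hr : r ∈ Ioo 0 (2 * M)) :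
    (coordU M t r, coordV M t r) ∈ innerRegion M H ↔ r < rMin M H := by
  have : areaRadius M (coordU M t r * coordV M t r) = r := areaRadius_coord hM hr
  constructor
  · intro h
    rw [← this]; exact h.2
  · intro h
    refine ⟨coord_mem_regionII hM hr, ?_⟩
    rw [← this] at h; exact h

/-- The reflection `(U, V) ↦ (-V, -U)` is `t ↦ -t`. -/
theorem coord_neg {M t r : ℝ} : coordU M (-t) r = -coordV M t r ∧
    coordV M (-t) r = -coordU M t r := by
  rw [coordU_eq, coordV_eq, coordU_eq, coordV_eq, neg_neg]
  constructor <;> congr 2 <;> ring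

/-! ### The leaves in the coordinates `(R, σ)` -/

/-- The point of the Kruskal plane on the leaf with `c = k_H(R)` that has the parameter `σ`. -/
noncomputable def param (M H : ℝ) (p : ℝ × ℝ) : ℝ × ℝ :=
  (coordU M (time M H p.1 p.2) (p.1 * (1 - p.2 ^ 2)),
    coordV M (time M H p.1 p.2) (p.1 * (1 - p.2 ^ 2)))

theorem one_sub_sq_mem {R σ : ℝ} (hR : 0 < R) (hσ : σ ∈ Ioo (-1) 1) :
    R * (1 - σ ^ 2) ∈ Ioc 0 R := by
  have h1 : σ ^ 2 < 1 := by nlinarith [hσ.1, hσ.2]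
  have h2 : 0 ≤ σ ^ 2 := sq_nonneg σ
  constructor <;> nlinarith

theorem one_sub_sq_mem' {M H R σ : ℝ} (hM : 0 < M) (hR : R ∈ Ioo 0 (rMin M H))
    (hσ : σ ∈ Ioo (-1) 1) : R * (1 - σ ^ 2) ∈ Ioo 0 (2 * M) :=
  have h := one_sub_sq_mem hR.1 hσ
  ⟨h.1, h.2.trans_lt (mem_Ioo_two_mul hM hR).2⟩

theorem leaf_eq_image {M H R : ℝ} (hM : 0 < M) (hR : R ∈ Ioo 0 (rMin M H)) :
    leaf M H (k M H R) = (fun σ => param M H (R, σ)) '' Ioo (-1) 1 := by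
  ext p
  constructor
  · rintro ⟨r, hr, t, ht, rfl⟩
    rw [rMinus_k hM hR] at hr
    have h1 : √(1 - r / R) ∈ Ico 0 1 := by
      have h2 : 0 < r / R := div_pos hr.1 hR.1
      exact ⟨Real.sqrt_nonneg _, (Real.sqrt_lt' one_pos).2 (by linarith)⟩
    have h3 := sqrt_one_sub_div hR.1 hr.2
    rw [height_eq hM hR ⟨hr.1.le, hr.2⟩] at ht
    rcases ht with rfl | rfl
    · refine ⟨√(1 - r / R), ⟨by linarith [h1.1], h1.2⟩, ?_⟩
      simp only [param, h3]
    · refine ⟨-√(1 - r / R), ⟨by linarith [h1.2], by linarith [h1.1]⟩, ?_⟩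
      simp only [param, time_neg, neg_sq, h3]
  · rintro ⟨σ, hσ, rfl⟩
    have h1 := one_sub_sq_mem hR.1 hσ
    refine ⟨R * (1 - σ ^ 2), by rwa [rMinus_k hM hR], time M H R σ, ?_, rfl⟩
    rcases le_total 0 σ with h0 | h0
    · exact Or.inl (height_mul hM hR ⟨h0, hσ.2.le⟩).symm
    · refine Or.inr ?_
      have := height_mul hM hR (σ := -σ) ⟨by linarith, by linarith [hσ.1]⟩
      rw [neg_sq, time_neg] at this
      rw [this, neg_neg]

theorem coord_mem_leaf_iff {M H R t r : ℝ} (hM : 0 < M) (hR : R ∈ Ioo 0 (rMin M H))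
    (hr : r ∈ Ioo 0 (2 * M)) : (coordU M t r, coordV M t r) ∈ leaf M H (k M H R) ↔
      r ≤ R ∧ |t| = time M H R √(1 - r / R) := by
  have hnn : ∀ x ∈ Ioc 0 R, 0 ≤ time M H R √(1 - x / R) := fun x hx => by
    have h2 : 0 < x / R := div_pos hx.1 hR.1
    have h1 : √(1 - x / R) ≤ 1 := Real.sqrt_le_one.2 (by linarith)
    have h3 := (strictMonoOn_time_right hM hR).monotoneOn (a := 0) (b := √(1 - x / R))
      ⟨by norm_num, by norm_num⟩ ⟨by linarith [Real.sqrt_nonneg (1 - x / R)], h1⟩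
      (Real.sqrt_nonneg _)
    rwa [time_zero] at h3
  constructor
  · rintro ⟨r', hr', t', ht, h⟩
    rw [rMinus_k hM hR] at hr'
    obtain ⟨rfl, rfl⟩ := coord_injective hM hr
      ⟨hr'.1, hr'.2.trans_lt (mem_Ioo_two_mul hM hR).2⟩ h
    refine ⟨hr'.2, ?_⟩
    rw [height_eq hM hR ⟨hr'.1.le, hr'.2⟩] at ht
    rw [← abs_of_nonneg (hnn r hr')]
    exact abs_eq_abs.2 ht
  · rintro ⟨h1, h2⟩
    refine ⟨r, by rw [rMinus_k hM hR]; exact ⟨hr.1, h1⟩, t, ?_, rfl⟩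
    rw [height_eq hM hR ⟨hr.1.le, h1⟩]
    rw [← abs_of_nonneg (hnn r ⟨hr.1, h1⟩)] at h2
    exact abs_eq_abs.1 h2

/-- Every point at time `t` and radius `r < r_H` lies on a leaf, because at fixed radius the time
coordinate of the leaves takes all values `≥ 0`. -/
theorem exists_time_eq {M H t r : ℝ} (hM : 0 < M) (hr : r ∈ Ioo 0 (rMin M H)) :
    ∃ R ∈ Ico r (rMin M H), |t| = time M H R √(1 - r / R) := by
  have h1 : ∀ᶠ R in 𝓝[<] (rMin M H), |t| ≤ time M H R √(1 - r / R) :=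
    (tendsto_time_rMin hM hr).eventually_ge_atTop _
  obtain ⟨R₁, hR₁, hR₁'⟩ := (h1.and (Ioo_mem_nhdsLT hr.2)).exists
  have h2 : ContinuousOn (fun R => time M H R √(1 - r / R)) (Icc r R₁) := by
    have hsub : ∀ R ∈ Icc r R₁, R ∈ Ioo 0 (rMin M H) := fun R hR =>
      ⟨hr.1.trans_le hR.1, hR.2.trans_lt hR₁'.2⟩
    exact (contDiffOn_time hM H).continuousOn.comp (f := fun R => (R, √(1 - r / R)))
      (ContinuousOn.prodMk continuousOn_id (ContinuousOn.sqrt (continuousOn_const.sub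
        (continuousOn_const.div continuousOn_id fun R hR => (hsub R hR).1.ne'))))
      fun R hR => ⟨hsub R hR, mem_univ _⟩
  obtain ⟨R, hR, hR'⟩ := intermediate_value_Icc hR₁'.1.le h2
    (show |t| ∈ Icc _ _ from ⟨by simp [div_self hr.1.ne', time_zero], hR₁⟩)
  exact ⟨R, ⟨hR.1, hR.2.trans_lt hR₁'.2⟩, hR'.symm⟩

theorem eq_of_mem_leaf {M H R R' : ℝ} (hM : 0 < M) (hR : R ∈ Ioo 0 (rMin M H))
    (hR' : R' ∈ Ioo 0 (rMin M H)) {p : ℝ × ℝ} (hp : p ∈ leaf M H (k M H R))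
    (hp' : p ∈ leaf M H (k M H R')) : R = R' := by
  have hp₀ := hp
  rw [leaf_eq_image hM hR] at hp₀
  obtain ⟨σ, hσ, rfl⟩ := hp₀
  have hr := one_sub_sq_mem hR.1 hσ
  have hr' := one_sub_sq_mem' hM hR hσ
  simp only [param] at hp hp'
  generalize R * (1 - σ ^ 2) = r at *
  generalize time M H R σ = t at *
  obtain ⟨h1, h2⟩ := (coord_mem_leaf_iff hM hR hr').1 hp
  obtain ⟨h3, h4⟩ := (coord_mem_leaf_iff hM hR' hr').1 hp'
  exact (strictMonoOn_time hM ⟨hr.1, hr.2.trans_lt hR.2⟩).injOn ⟨h1, hR.2⟩ ⟨h3, hR'.2⟩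
    (h2.symm.trans h4)

/-- The leaf has exactly one point at time `t` as soon as `|t| < f(0; H, c)`, because `t` increases
along it. The radius of that point tends to `r_H`, because at every radius below `r_H` the leaf
finally lies above time `|t|`. -/
theorem exists_tendsto_radius {M : ℝ} (hM : 0 < M) (H t : ℝ) : ∃ ρ : ℝ → ℝ,
    (∀ᶠ c in 𝓝[>] (cMin M H), ρ c ∈ Ioo 0 (2 * M) ∧ ∀ r ∈ Ioo 0 (2 * M),
      (coordU M t r, coordV M t r) ∈ leaf M H c ↔ r = ρ c) ∧
    Tendsto ρ (𝓝[>] (cMin M H)) (𝓝 (rMin M H)) := by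
  have hI : ∀ᶠ c in 𝓝[>] (cMin M H), c ∈ Ioo (cMin M H) 0 := Ioo_mem_nhdsGT (cMin_neg hM H)
  have hex : ∀ c, c ∈ Ioo (cMin M H) 0 → |t| < height M H c 0 →
      ∃ ρ ∈ Ioc 0 (rMinus M H c), ∀ r ∈ Ioo 0 (2 * M),
        (coordU M t r, coordV M t r) ∈ leaf M H c ↔ r = ρ := by
    intro c hc hlt
    have hR := rMinus_mem hM hc
    rw [height_rMinus hM hc] at hlt
    obtain ⟨σ, hσ, hσt⟩ := intermediate_value_Ico zero_le_one
      (continuous_time hM hR).continuousOn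
      (show |t| ∈ Ico _ _ from ⟨by rw [time_zero]; exact abs_nonneg t, hlt⟩)
    have hσ' : σ ∈ Ioo (-1 : ℝ) 1 := ⟨by linarith [hσ.1], hσ.2⟩
    refine ⟨rMinus M H c * (1 - σ ^ 2), one_sub_sq_mem hR.1 hσ', fun r hr => ?_⟩
    have h1 := coord_mem_leaf_iff (t := t) hM hR hr
    rw [k_rMinus hM hc] at h1
    rw [h1]
    generalize rMinus M H c = R at *
    constructor
    · rintro ⟨h2, h3⟩
      have h4 : 0 < r / R := div_pos hr.1 hR.1
      have h5 : √(1 - r / R) = σ := (strictMonoOn_time_right hM hR).injOn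
        ⟨by linarith [Real.sqrt_nonneg (1 - r / R)], Real.sqrt_le_one.2 (by linarith)⟩
        (Ioo_subset_Icc_self hσ') (h3.symm.trans hσt.symm)
      rw [← h5, sqrt_one_sub_div hR.1 h2]
    · rintro rfl
      refine ⟨(one_sub_sq_mem hR.1 hσ').2, ?_⟩
      have hR0 := hR.1.ne'
      rw [show 1 - R * (1 - σ ^ 2) / R = σ ^ 2 by field_simp; ring, Real.sqrt_sq hσ.1, hσt]
  choose! ρ hρ1 hρ2 using hex
  have hev : ∀ᶠ c in 𝓝[>] (cMin M H), c ∈ Ioo (cMin M H) 0 ∧ |t| < height M H c 0 :=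
    hI.and ((tendsto_height_cMin hM H).eventually_gt_atTop _)
  refine ⟨ρ, ?_, tendsto_order.2 ⟨fun a ha => ?_, fun a ha => ?_⟩⟩
  · filter_upwards [hev] with c hc
    have h1 := hρ1 c hc.1 hc.2
    have h2 := mem_Ioo_two_mul hM (rMinus_mem hM hc.1)
    exact ⟨⟨h1.1, h1.2.trans_lt h2.2⟩, hρ2 c hc.1 hc.2⟩
  · -- the leaf lies above time `|t|` at every radius below `b`
    have h0 := (rMin_spec hM H).1.1
    set b := max a (rMin M H / 2)
    have hb : b ∈ Ioo 0 (rMin M H) := ⟨lt_max_of_lt_right (by linarith), max_lt ha (by linarith)⟩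
    filter_upwards [hev, (tendsto_rMinus_cMin hM H).eventually
      (((tendsto_time_rMin hM hb).eventually_gt_atTop |t|).and (Ioo_mem_nhdsLT hb.2))]
      with c hc hcb
    have h1 := hρ1 c hc.1 hc.2
    have hR := rMinus_mem hM hc.1
    have h2 : ρ c ∈ Ioo 0 (2 * M) := ⟨h1.1, h1.2.trans_lt (mem_Ioo_two_mul hM hR).2⟩
    have h3 := (hρ2 c hc.1 hc.2 _ h2).2 rfl
    refine (le_max_left _ _).trans_lt (show b < ρ c from ?_)
    generalize ρ c = x at *
    rw [← k_rMinus hM hc.1, coord_mem_leaf_iff hM hR h2] at h3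
    by_contra hle
    rw [not_lt] at hle
    have h4 := hcb.1
    rw [h3.2] at h4
    generalize rMinus M H c = R at *
    have h5 : ∀ x ∈ Ioc 0 R, √(1 - x / R) ∈ Icc (-1 : ℝ) 1 := fun x hx =>
      ⟨by linarith [Real.sqrt_nonneg (1 - x / R)],
        Real.sqrt_le_one.2 (by linarith [div_pos hx.1 hR.1])⟩
    have h6 : √(1 - b / R) ≤ √(1 - x / R) := Real.sqrt_le_sqrt
      (by have := div_le_div_of_nonneg_right hle hR.1.le; linarith)
    have h7 := (strictMonoOn_time_right hM hR).monotoneOn (h5 b ⟨hb.1, hcb.2.1.le⟩) (h5 _ h1) h6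
    linarith
  · filter_upwards [hev] with c hc
    exact ((hρ1 c hc.1 hc.2).2.trans_lt (rMinus_mem hM hc.1).2).trans ha

/-! ### The foliation -/

theorem hasDerivAt_tortoise {M r : ℝ} (hr : r ≠ 2 * M) :
    HasDerivAt (tortoise M) (r / (r - 2 * M)) r := by
  have h0 : r - 2 * M ≠ 0 := sub_ne_zero.2 hr
  have h1 : HasDerivAt (fun r => r + 2 * M * Real.log (r - 2 * M))
      (1 + 2 * M * (1 / (r - 2 * M))) r :=
    (hasDerivAt_id r).fun_add ((((hasDerivAt_id r).sub_const (2 * M)).log h0).const_mul (2 * M))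
  have h2 : tortoise M = fun r => r + 2 * M * Real.log (r - 2 * M) := by
    funext r; rw [tortoise, Real.log_abs]
  rw [h2]
  refine h1.congr_deriv ?_
  field_simp; ring

theorem contDiffAt_tortoise {M r : ℝ} (hr : r ≠ 2 * M) : ContDiffAt ℝ ∞ (tortoise M) r := by
  have h0 : r - 2 * M ≠ 0 := sub_ne_zero.2 hr
  have h2 : tortoise M = fun r => r + 2 * M * Real.log (r - 2 * M) := by
    funext r; rw [tortoise, Real.log_abs]
  rw [h2]
  exact contDiffAt_id.add (contDiffAt_const.mul
    ((contDiffAt_id.sub contDiffAt_const).log h0))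

theorem contDiffOn_param {M : ℝ} (hM : 0 < M) (H : ℝ) :
    ContDiffOn ℝ ∞ (param M H) (Ioo 0 (rMin M H) ×ˢ Ioo (-1) 1) := by
  intro p hp
  have h1 : ContDiffAt ℝ ∞ (fun p : ℝ × ℝ => time M H p.1 p.2) p :=
    (contDiffOn_time hM H).contDiffAt ((isOpen_Ioo.prod isOpen_univ).mem_nhds
      ⟨hp.1, mem_univ _⟩)
  have h0 : ContDiffAt ℝ ∞ (fun p : ℝ × ℝ => p.1 * (1 - p.2 ^ 2)) p := by fun_prop
  have h2 : ContDiffAt ℝ ∞ (fun p : ℝ × ℝ => tortoise M (p.1 * (1 - p.2 ^ 2))) p :=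
    ContDiffAt.comp (g := tortoise M) p
      (contDiffAt_tortoise (one_sub_sq_mem' hM hp.1 hp.2).2.ne) h0
  have h3 : ContDiffAt ℝ ∞ (fun p : ℝ × ℝ =>
      -Real.exp (-(time M H p.1 p.2 - tortoise M (p.1 * (1 - p.2 ^ 2))) / (4 * M))) p :=
    (((h1.sub h2).neg.div_const (4 * M)).exp).neg
  have h4 : ContDiffAt ℝ ∞ (fun p : ℝ × ℝ =>
      Real.exp ((time M H p.1 p.2 + tortoise M (p.1 * (1 - p.2 ^ 2))) / (4 * M))) p :=
    ((h1.add h2).div_const (4 * M)).exp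
  exact (h3.prodMk h4).contDiffWithinAt

theorem exists_equiv_of_hasFDerivAt {f : ℝ × ℝ → ℝ × ℝ} {Φ : (ℝ × ℝ) →L[ℝ] (ℝ × ℝ)}
    {p : ℝ × ℝ} (hf : HasFDerivAt f Φ p) (h : ∀ v, Φ v = 0 → v = 0) :
    ∃ e : (ℝ × ℝ) ≃L[ℝ] (ℝ × ℝ), HasFDerivAt f (e : (ℝ × ℝ) →L[ℝ] (ℝ × ℝ)) p :=
  ⟨(LinearEquiv.ofInjectiveEndo (Φ : (ℝ × ℝ) →ₗ[ℝ] (ℝ × ℝ))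
    ((injective_iff_map_eq_zero _).2 h)).toContinuousLinearEquiv, hf⟩

/-- The map `(R, σ) ↦ (U, V)` is an immersion. -/
theorem exists_hasFDerivAt_param {M H : ℝ} (hM : 0 < M) {p : ℝ × ℝ}
    (hp : p ∈ Ioo 0 (rMin M H) ×ˢ Ioo (-1 : ℝ) 1) :
    ∃ e : (ℝ × ℝ) ≃L[ℝ] (ℝ × ℝ), HasFDerivAt (param M H) (e : (ℝ × ℝ) →L[ℝ] (ℝ × ℝ)) p := by
  obtain ⟨R, σ⟩ := p
  have hR : R ∈ Ioo 0 (rMin M H) := hp.1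
  have hσ : σ ∈ Ioo (-1 : ℝ) 1 := hp.2
  have hr := one_sub_sq_mem' hM hR hσ
  have hJ := jacobian_pos hM hR hσ
  have hT := hasFDerivAt_time hM hR σ
  have hr2 : HasDerivAt (fun σ : ℝ => 1 - σ ^ 2) (-(2 * σ)) σ := by
    simpa using (hasDerivAt_pow 2 σ).const_sub 1
  have hrad : HasFDerivAt (fun p : ℝ × ℝ => p.1 * (1 - p.2 ^ 2))
      (R • (-(2 * σ)) • ContinuousLinearMap.snd ℝ ℝ ℝ +
        (1 - σ ^ 2) • ContinuousLinearMap.fst ℝ ℝ ℝ) (R, σ) :=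
    hasFDerivAt_fst.mul (HasDerivAt.comp_hasFDerivAt (f := Prod.snd) (R, σ) hr2 hasFDerivAt_snd)
  set T' := timeDeriv M H R σ • ContinuousLinearMap.fst ℝ ℝ ℝ +
        speed M H (R, σ) • ContinuousLinearMap.snd ℝ ℝ ℝ with hT'
  set r' := R • (-(2 * σ)) • ContinuousLinearMap.snd ℝ ℝ ℝ +
        (1 - σ ^ 2) • ContinuousLinearMap.fst ℝ ℝ ℝ with hr'
  have htor := (hasDerivAt_tortoise hr.2.ne).comp_hasFDerivAt (R, σ) hrad
  set a := R * (1 - σ ^ 2) / (R * (1 - σ ^ 2) - 2 * M) with ha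
  have ha0 : a ≠ 0 := div_ne_zero hr.1.ne' (sub_neg.2 hr.2).ne
  have hU : ∀ u : ℝ, HasDerivAt (fun u => -Real.exp (-u / (4 * M)))
      (Real.exp (-u / (4 * M)) / (4 * M)) u := fun u => by
    refine (((hasDerivAt_neg u).div_const (4 * M)).exp).neg.congr_deriv ?_
    ring
  have hV : ∀ u : ℝ, HasDerivAt (fun u => Real.exp (u / (4 * M)))
      (Real.exp (u / (4 * M)) / (4 * M)) u := fun u => by
    refine (((hasDerivAt_id u).div_const (4 * M)).exp).congr_deriv ?_
    simp only [id]; ring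
  have hUf := (hU (time M H R σ - tortoise M (R * (1 - σ ^ 2)))).comp_hasFDerivAt (R, σ)
    (hT.fun_sub htor)
  have hVf := (hV (time M H R σ + tortoise M (R * (1 - σ ^ 2)))).comp_hasFDerivAt (R, σ)
    (hT.fun_add htor)
  have hP := hUf.prodMk hVf
  refine exists_equiv_of_hasFDerivAt hP fun v hv => ?_
  obtain ⟨h1, h2⟩ := Prod.mk.inj hv
  have hu0 : Real.exp (-(time M H R σ - tortoise M (R * (1 - σ ^ 2))) / (4 * M)) / (4 * M) ≠ 0 := by
    positivity
  have hv0 : Real.exp ((time M H R σ + tortoise M (R * (1 - σ ^ 2))) / (4 * M)) / (4 * M) ≠ 0 := by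
    positivity
  have h1' : T' v - a * r' v = 0 := (mul_eq_zero.1 h1).resolve_left hu0
  have h2' : T' v + a * r' v = 0 := (mul_eq_zero.1 h2).resolve_left hv0
  have h3 : T' v = 0 := by linarith
  have h4 : r' v = 0 := (mul_eq_zero.1 (by linarith : a * r' v = 0)).resolve_left ha0
  have h3' : timeDeriv M H R σ * v.1 + speed M H (R, σ) * v.2 = 0 := h3
  have h4' : R * (-(2 * σ) * v.2) + (1 - σ ^ 2) * v.1 = 0 := h4
  have h5 : ((1 - σ ^ 2) * speed M H (R, σ) + 2 * R * σ * timeDeriv M H R σ) * v.1 = 0 := by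
    linear_combination (2 * R * σ) * h3' + speed M H (R, σ) * h4'
  have h6 : ((1 - σ ^ 2) * speed M H (R, σ) + 2 * R * σ * timeDeriv M H R σ) * v.2 = 0 := by
    linear_combination (1 - σ ^ 2) * h3' - timeDeriv M H R σ * h4'
  exact Prod.ext ((mul_eq_zero.1 h5).resolve_left hJ.ne') ((mul_eq_zero.1 h6).resolve_left hJ.ne')

theorem isOpen_innerRegion {M : ℝ} (hM : 0 < M) (H : ℝ) : IsOpen (innerRegion M H) := by
  have h0 := (rMin_spec hM H).1.1
  have h1 : innerRegion M H = {p | -2 * M < p.1 * p.2 ∧ p.1 < 0 ∧ 0 < p.2 ∧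
      p.1 * p.2 < radiusProd M (rMin M H)} := by
    ext p
    constructor
    · rintro ⟨⟨hp, hU, hV⟩, hr⟩
      exact ⟨hp, hU, hV, (areaRadius_lt_iff hM hp h0).1 hr⟩
    · rintro ⟨hp, hU, hV, hr⟩
      exact ⟨⟨hp, hU, hV⟩, (areaRadius_lt_iff hM hp h0).2 hr⟩
  rw [h1]
  simp only [ofPred_and]
  refine IsOpen.inter ?_ (IsOpen.inter ?_ (IsOpen.inter ?_ ?_)) <;>
    exact isOpen_lt (by fun_prop) (by fun_prop)

theorem param_mem_leaf {M H R σ : ℝ} (hM : 0 < M) (hR : R ∈ Ioo 0 (rMin M H))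
    (hσ : σ ∈ Ioo (-1) 1) : param M H (R, σ) ∈ leaf M H (k M H R) := by
  rw [leaf_eq_image hM hR]
  exact mem_image_of_mem _ hσ

theorem param_mem_innerRegion {M H : ℝ} (hM : 0 < M) {p : ℝ × ℝ}
    (hp : p ∈ Ioo 0 (rMin M H) ×ˢ Ioo (-1 : ℝ) 1) : param M H p ∈ innerRegion M H :=
  (coord_mem_innerRegion_iff hM (one_sub_sq_mem' hM hp.1 hp.2)).2
    ((one_sub_sq_mem hp.1.1 hp.2).2.trans_lt hp.1.2)

theorem exists_param_eq {M H : ℝ} (hM : 0 < M) {q : ℝ × ℝ} (hq : q ∈ innerRegion M H) :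
    ∃ p ∈ Ioo 0 (rMin M H) ×ˢ Ioo (-1 : ℝ) 1, param M H p = q := by
  obtain ⟨t, r, hr, rfl⟩ := exists_coord_eq hM hq.1
  have hr' : r ∈ Ioo 0 (rMin M H) := ⟨hr.1, (coord_mem_innerRegion_iff hM hr).1 hq⟩
  obtain ⟨R, hR, ht⟩ := exists_time_eq (t := t) hM hr'
  have hR' : R ∈ Ioo 0 (rMin M H) := ⟨hr.1.trans_le hR.1, hR.2⟩
  have h1 := (coord_mem_leaf_iff hM hR' hr).2 ⟨hR.1, ht⟩
  rw [leaf_eq_image hM hR'] at h1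
  obtain ⟨σ, hσ, h2⟩ := h1
  exact ⟨(R, σ), ⟨hR', hσ⟩, h2⟩

theorem isFoliation_leaf {M : ℝ} (hM : 0 < M) (H : ℝ) :
    IsFoliation (innerRegion M H) (Ioo (cMin M H) 0) (leaf M H) where
  isOpen := isOpen_innerRegion hM H
  disjoint := by
    intro c hc c' hc' hne
    refine Set.disjoint_left.2 fun p hp hp' => hne ?_
    rw [← k_rMinus hM hc] at hp ⊢
    rw [← k_rMinus hM hc'] at hp' ⊢
    rw [eq_of_mem_leaf hM (rMinus_mem hM hc) (rMinus_mem hM hc') hp hp']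
  cover := by
    ext q
    simp only [mem_iUnion, exists_prop]
    constructor
    · rintro ⟨c, hc, hq⟩
      have hR := rMinus_mem hM hc
      rw [← k_rMinus hM hc, leaf_eq_image hM hR] at hq
      obtain ⟨σ, hσ, rfl⟩ := hq
      exact param_mem_innerRegion hM ⟨hR, hσ⟩
    · intro hq
      obtain ⟨p, hp, rfl⟩ := exists_param_eq hM hq
      exact ⟨k M H p.1, k_mem_Ioo hM hp.1, param_mem_leaf hM hp.1 hp.2⟩
  chart := by
    intro q hq
    obtain ⟨p, hp, rfl⟩ := exists_param_eq hM hq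
    have hO : IsOpen (Ioo 0 (rMin M H) ×ˢ Ioo (-1 : ℝ) 1) := isOpen_Ioo.prod isOpen_Ioo
    have hsm : ∀ p ∈ Ioo 0 (rMin M H) ×ˢ Ioo (-1 : ℝ) 1, ContDiffAt ℝ ∞ (param M H) p :=
      fun p hp => (contDiffOn_param hM H).contDiffAt (hO.mem_nhds hp)
    obtain ⟨e', he'⟩ := exists_hasFDerivAt_param hM hp
    set E := ((hsm p hp).toOpenPartialHomeomorph (param M H) he' (by simp)).restrOpen _ hO with hE
    have hEsub : E.source ⊆ Ioo 0 (rMin M H) ×ˢ Ioo (-1 : ℝ) 1 := fun x hx => hx.2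
    have hEcoe : ∀ x, E x = param M H x := fun x => rfl
    have hpE : p ∈ E.source :=
      ⟨(hsm p hp).mem_toOpenPartialHomeomorph_source he' (by simp), hp⟩
    -- every point of the target has the coordinates `E.symm`, so lies on the leaf of `E.symm`
    have hleaf : ∀ q ∈ E.target, E.symm q ∈ Ioo 0 (rMin M H) ×ˢ Ioo (-1 : ℝ) 1 ∧
        q = param M H (E.symm q) := fun q hq =>
      ⟨hEsub (E.map_target hq), (E.right_inv hq).symm⟩
    refine ⟨E.symm, E.map_source hpE, ?_, ?_, ?_, ?_⟩
    · intro q hq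
      obtain ⟨h1, h2⟩ := hleaf q hq
      rw [h2]
      exact param_mem_innerRegion hM h1
    · intro q hq
      obtain ⟨h1, -⟩ := hleaf q hq
      obtain ⟨e'', he''⟩ := exists_hasFDerivAt_param hM h1
      exact (E.contDiffAt_symm hq he'' (hsm _ h1)).contDiffWithinAt
    · intro x hx
      exact (hsm x (hEsub hx)).contDiffWithinAt
    · intro q hq q' hq'
      obtain ⟨h1, h2⟩ := hleaf q hq
      obtain ⟨h3, h4⟩ := hleaf q' hq'
      have h5 := param_mem_leaf hM h1.1 h1.2
      have h6 := param_mem_leaf hM h3.1 h3.2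
      rw [← h2] at h5
      rw [← h4] at h6
      constructor
      · rintro ⟨c, hc, hc1, hc2⟩
        have hR := rMinus_mem hM hc
        rw [← k_rMinus hM hc] at hc1 hc2
        rw [← eq_of_mem_leaf hM hR h1.1 hc1 h5, ← eq_of_mem_leaf hM hR h3.1 hc2 h6]
      · intro h
        exact ⟨_, k_mem_Ioo hM h1.1, h5, h ▸ h6⟩

/-! ### The mean curvature of a spherically symmetric hypersurface -/

/-- The component `g(∂_U, ∂_V)` of the Kruskal metric as a function of `w = UV`. -/
noncomputable def nullComp (M w : ℝ) : ℝ :=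
  8 * M ^ 2 * Real.exp (-areaRadius M w / (2 * M)) / areaRadius M w

/-- The derivative `dr/dw` of the area radius. -/
noncomputable def areaRadiusDeriv (M w : ℝ) : ℝ :=
  2 * M * Real.exp (-areaRadius M w / (2 * M)) / areaRadius M w

/-- The derivative of `nullComp`. -/
noncomputable def nullCompDeriv (M w : ℝ) : ℝ :=
  -nullComp M w * (1 / (2 * M) + 1 / areaRadius M w) * areaRadiusDeriv M w

theorem metric_eq (M : ℝ) (x : Fin 4 → ℝ) : metric M x =
    !![0, nullComp M (x 0 * x 1), 0, 0;
       nullComp M (x 0 * x 1), 0, 0, 0;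
       0, 0, areaRadius M (x 0 * x 1) ^ 2, 0;
       0, 0, 0, areaRadius M (x 0 * x 1) ^ 2 * Real.sin (x 2) ^ 2] := rfl

theorem nullComp_pos {M w : ℝ} (hM : 0 < M) (hw : -2 * M < w) : 0 < nullComp M w := by
  have := areaRadius_pos hM hw
  unfold nullComp; positivity

theorem hasDerivAt_nullComp {M w : ℝ} (hM : 0 < M) (hw : -2 * M < w) :
    HasDerivAt (nullComp M) (nullCompDeriv M w) w := by
  have h0 := areaRadius_pos hM hw
  have h1 := hasDerivAt_areaRadius hM hw
  have h2 := (((h1.fun_neg.div_const (2 * M)).exp).const_mul (8 * M ^ 2)).fun_div h1 h0.ne'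
  refine h2.congr_deriv ?_
  rw [nullCompDeriv, areaRadiusDeriv, nullComp]
  field_simp; ring

theorem hasDerivAt_comp_mul_left {f : ℝ → ℝ} {f' u v : ℝ} (hf : HasDerivAt f f' (u * v)) :
    HasDerivAt (fun s => f (s * v)) (f' * v) u := by
  have h1 : HasDerivAt (fun s : ℝ => s * v) v u := by simpa using (hasDerivAt_id u).mul_const v
  exact HasDerivAt.comp (h₂ := f) u hf h1

theorem hasDerivAt_comp_mul_right {f : ℝ → ℝ} {f' u v : ℝ} (hf : HasDerivAt f f' (u * v)) :
    HasDerivAt (fun s => f (u * s)) (f' * u) v := by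
  have h1 : HasDerivAt (fun s : ℝ => u * s) u v := by simpa using (hasDerivAt_id v).const_mul u
  exact HasDerivAt.comp (h₂ := f) v hf h1

theorem inv_metric {M : ℝ} (hM : 0 < M) {x : Fin 4 → ℝ} (hx : -2 * M < x 0 * x 1)
    (hs : Real.sin (x 2) ≠ 0) : (metric M x)⁻¹ =
    !![0, (nullComp M (x 0 * x 1))⁻¹, 0, 0;
       (nullComp M (x 0 * x 1))⁻¹, 0, 0, 0;
       0, 0, (areaRadius M (x 0 * x 1) ^ 2)⁻¹, 0;
       0, 0, 0, (areaRadius M (x 0 * x 1) ^ 2 * Real.sin (x 2) ^ 2)⁻¹] := by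
  have h1 := (nullComp_pos hM hx).ne'
  have h2 := (areaRadius_pos hM hx).ne'
  refine Matrix.inv_eq_right_inv ?_
  rw [metric_eq]
  ext i j
  fin_cases i <;> fin_cases j <;>
    simp [Matrix.mul_apply, Fin.sum_univ_four, h1, h2]
  field_simp

theorem christoffel_zero {M : ℝ} (hM : 0 < M) {x : Fin 4 → ℝ} (hx : -2 * M < x 0 * x 1)
    (hs : Real.sin (x 2) ≠ 0) (i j : Fin 4) : christoffel (metric M) 0 i j x =
      1 / 2 * ((nullComp M (x 0 * x 1))⁻¹ * (partialDeriv i (fun y => metric M y j 1) x +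
        partialDeriv j (fun y => metric M y i 1) x -
        partialDeriv 1 (fun y => metric M y i j) x)) := by
  rw [christoffel, inv_metric hM hx hs]
  simp [Fin.sum_univ_four]

theorem christoffel_one {M : ℝ} (hM : 0 < M) {x : Fin 4 → ℝ} (hx : -2 * M < x 0 * x 1)
    (hs : Real.sin (x 2) ≠ 0) (i j : Fin 4) : christoffel (metric M) 1 i j x =
      1 / 2 * ((nullComp M (x 0 * x 1))⁻¹ * (partialDeriv i (fun y => metric M y j 0) x +
        partialDeriv j (fun y => metric M y i 0) x -
        partialDeriv 0 (fun y => metric M y i j) x)) := by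
  rw [christoffel, inv_metric hM hx hs]
  simp [Fin.sum_univ_four]

theorem partialDeriv_const {n : ℕ} (i : Fin n) (a : ℝ) (x : Fin n → ℝ) :
    partialDeriv i (fun _ => a) x = 0 := by simp [partialDeriv]

section

variable {M : ℝ} {x : Fin 4 → ℝ}

theorem partialDeriv_zero_nullComp (hM : 0 < M) (hx : -2 * M < x 0 * x 1) :
    partialDeriv 0 (fun y : Fin 4 → ℝ => nullComp M (y 0 * y 1)) x =
      nullCompDeriv M (x 0 * x 1) * x 1 := by
  simpa [partialDeriv] using (hasDerivAt_comp_mul_left (hasDerivAt_nullComp hM hx)).deriv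

theorem partialDeriv_one_nullComp (hM : 0 < M) (hx : -2 * M < x 0 * x 1) :
    partialDeriv 1 (fun y : Fin 4 → ℝ => nullComp M (y 0 * y 1)) x =
      nullCompDeriv M (x 0 * x 1) * x 0 := by
  simpa [partialDeriv] using (hasDerivAt_comp_mul_right (hasDerivAt_nullComp hM hx)).deriv

theorem partialDeriv_zero_sq (hM : 0 < M) (hx : -2 * M < x 0 * x 1) (q : ℝ → ℝ) :
    partialDeriv 0 (fun y : Fin 4 → ℝ => areaRadius M (y 0 * y 1) ^ 2 * q (y 2)) x =
      2 * areaRadius M (x 0 * x 1) * areaRadiusDeriv M (x 0 * x 1) * x 1 * q (x 2) := by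
  have h1 := ((hasDerivAt_comp_mul_left (hasDerivAt_areaRadius hM hx)).fun_pow 2).mul_const
    (q (x 2))
  refine Eq.trans (b := deriv (fun s => areaRadius M (s * x 1) ^ 2 * q (x 2)) _) ?_
    (h1.deriv.trans ?_)
  · simp [partialDeriv]
  · rw [areaRadiusDeriv]; push_cast; ring

theorem partialDeriv_one_sq (hM : 0 < M) (hx : -2 * M < x 0 * x 1) (q : ℝ → ℝ) :
    partialDeriv 1 (fun y : Fin 4 → ℝ => areaRadius M (y 0 * y 1) ^ 2 * q (y 2)) x =
      2 * areaRadius M (x 0 * x 1) * areaRadiusDeriv M (x 0 * x 1) * x 0 * q (x 2) := by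
  have h1 := ((hasDerivAt_comp_mul_right (hasDerivAt_areaRadius hM hx)).fun_pow 2).mul_const
    (q (x 2))
  refine Eq.trans (b := deriv (fun s => areaRadius M (x 0 * s) ^ 2 * q (x 2)) _) ?_
    (h1.deriv.trans ?_)
  · simp [partialDeriv]
  · rw [areaRadiusDeriv]; push_cast; ring

end

theorem tangent_rotate_zero (γ : ℝ → ℝ × ℝ) (y : Fin 3 → ℝ) : tangent (rotate γ) 0 y =
    ![deriv (fun s => (γ s).1) (y 0), deriv (fun s => (γ s).2) (y 0), 0, 0] := by
  ext k
  fin_cases k <;> simp [tangent, rotate, partialDeriv]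

theorem tangent_rotate_one (γ : ℝ → ℝ × ℝ) (y : Fin 3 → ℝ) :
    tangent (rotate γ) 1 y = ![0, 0, 1, 0] := by
  ext k
  fin_cases k <;> simp [tangent, rotate, partialDeriv]

theorem tangent_rotate_two (γ : ℝ → ℝ × ℝ) (y : Fin 3 → ℝ) :
    tangent (rotate γ) 2 y = ![0, 0, 0, 1] := by
  ext k
  fin_cases k <;> simp [tangent, rotate, partialDeriv]

theorem scalar_metric (M : ℝ) (x v w : Fin 4 → ℝ) : scalar (metric M x) v w =
    nullComp M (x 0 * x 1) * (v 0 * w 1 + v 1 * w 0) +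
      areaRadius M (x 0 * x 1) ^ 2 * (v 2 * w 2 + Real.sin (x 2) ^ 2 * (v 3 * w 3)) := by
  rw [scalar, metric_eq]
  simp [Fin.sum_univ_four]
  ring

theorem firstForm_rotate (M : ℝ) (γ : ℝ → ℝ × ℝ) (s θ φ : ℝ) :
    firstForm (metric M) (rotate γ) ![s, θ, φ] = Matrix.diagonal
      ![2 * nullComp M ((γ s).1 * (γ s).2) *
          (deriv (fun s => (γ s).1) s * deriv (fun s => (γ s).2) s),
        areaRadius M ((γ s).1 * (γ s).2) ^ 2,
        areaRadius M ((γ s).1 * (γ s).2) ^ 2 * Real.sin θ ^ 2] := by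
  ext i j
  fin_cases i <;> fin_cases j <;>
    simp [firstForm, scalar_metric, tangent_rotate_zero, tangent_rotate_one, tangent_rotate_two,
      rotate]
  ring

theorem covTangent_rotate_zero {M : ℝ} (hM : 0 < M) (γ : ℝ → ℝ × ℝ) {s θ : ℝ} (φ : ℝ)
    (hw : -2 * M < (γ s).1 * (γ s).2) (hθ : Real.sin θ ≠ 0) :
    covTangent (metric M) (rotate γ) 0 0 ![s, θ, φ] 0 =
        deriv (deriv fun s => (γ s).1) s + (nullComp M ((γ s).1 * (γ s).2))⁻¹ *
          nullCompDeriv M ((γ s).1 * (γ s).2) * (γ s).2 * deriv (fun s => (γ s).1) s ^ 2 ∧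
      covTangent (metric M) (rotate γ) 0 0 ![s, θ, φ] 1 =
        deriv (deriv fun s => (γ s).2) s + (nullComp M ((γ s).1 * (γ s).2))⁻¹ *
          nullCompDeriv M ((γ s).1 * (γ s).2) * (γ s).1 * deriv (fun s => (γ s).2) s ^ 2 := by
  set x := rotate γ ![s, θ, φ] with hx
  have hw' : -2 * M < x 0 * x 1 := hw
  have hθ' : Real.sin (x 2) ≠ 0 := hθ
  constructor
  all_goals
    simp only [covTangent, ← hx, tangent_rotate_zero, Fin.sum_univ_four,
      christoffel_zero hM hw' hθ', christoffel_one hM hw' hθ']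
    simp [metric_eq, partialDeriv_const, partialDeriv_zero_nullComp hM hw',
      partialDeriv_one_nullComp hM hw']
    simp [partialDeriv, hx, rotate]
    ring

theorem covTangent_rotate_one {M : ℝ} (hM : 0 < M) (γ : ℝ → ℝ × ℝ) {s θ : ℝ} (φ : ℝ)
    (hw : -2 * M < (γ s).1 * (γ s).2) (hθ : Real.sin θ ≠ 0) :
    covTangent (metric M) (rotate γ) 1 1 ![s, θ, φ] 0 =
        -(areaRadius M ((γ s).1 * (γ s).2) * areaRadiusDeriv M ((γ s).1 * (γ s).2) * (γ s).1 /
          nullComp M ((γ s).1 * (γ s).2)) ∧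
      covTangent (metric M) (rotate γ) 1 1 ![s, θ, φ] 1 =
        -(areaRadius M ((γ s).1 * (γ s).2) * areaRadiusDeriv M ((γ s).1 * (γ s).2) * (γ s).2 /
          nullComp M ((γ s).1 * (γ s).2)) := by
  set x := rotate γ ![s, θ, φ] with hx
  have hw' : -2 * M < x 0 * x 1 := hw
  have hθ' : Real.sin (x 2) ≠ 0 := hθ
  have h1 := partialDeriv_zero_sq hM hw' fun _ => 1
  have h2 := partialDeriv_one_sq hM hw' fun _ => 1
  simp only [mul_one] at h1 h2
  constructor
  all_goals
    simp only [covTangent, ← hx, tangent_rotate_one, Fin.sum_univ_four,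
      christoffel_zero hM hw' hθ', christoffel_one hM hw' hθ']
    simp [metric_eq, partialDeriv_const, h1, h2]
    simp [hx, rotate]
    ring

theorem covTangent_rotate_two {M : ℝ} (hM : 0 < M) (γ : ℝ → ℝ × ℝ) {s θ : ℝ} (φ : ℝ)
    (hw : -2 * M < (γ s).1 * (γ s).2) (hθ : Real.sin θ ≠ 0) :
    covTangent (metric M) (rotate γ) 2 2 ![s, θ, φ] 0 =
        -(areaRadius M ((γ s).1 * (γ s).2) * areaRadiusDeriv M ((γ s).1 * (γ s).2) * (γ s).1 /
          nullComp M ((γ s).1 * (γ s).2)) * Real.sin θ ^ 2 ∧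
      covTangent (metric M) (rotate γ) 2 2 ![s, θ, φ] 1 =
        -(areaRadius M ((γ s).1 * (γ s).2) * areaRadiusDeriv M ((γ s).1 * (γ s).2) * (γ s).2 /
          nullComp M ((γ s).1 * (γ s).2)) * Real.sin θ ^ 2 := by
  set x := rotate γ ![s, θ, φ] with hx
  have hw' : -2 * M < x 0 * x 1 := hw
  have hθ' : Real.sin (x 2) ≠ 0 := hθ
  have h1 := partialDeriv_zero_sq hM hw' fun t => Real.sin t ^ 2
  have h2 := partialDeriv_one_sq hM hw' fun t => Real.sin t ^ 2
  constructor
  all_goals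
    simp only [covTangent, ← hx, tangent_rotate_two, Fin.sum_univ_four,
      christoffel_zero hM hw' hθ', christoffel_one hM hw' hθ']
    simp [metric_eq, partialDeriv_const, h1, h2]
    simp [hx, rotate]
    ring

/-- The mean curvature equation for the hypersurface generated by a curve with increasing null
coordinates: `λ (U', -V', 0, 0)` with `λ = -(2 g(∂_U, ∂_V) U' V')^{-1/2}` is the future directed
unit normal. -/
theorem isSpacelikeWithMeanCurvature_rotate {M H : ℝ} (hM : 0 < M) (γ : ℝ → ℝ × ℝ) {s θ : ℝ}
    (φ : ℝ) (hw : -2 * M < (γ s).1 * (γ s).2) (hθ : θ ∈ Ioo 0 Real.pi) {a b a' b' v : ℝ}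
    (ha : deriv (fun s => (γ s).1) s = a) (hb : deriv (fun s => (γ s).2) s = b)
    (ha' : deriv (deriv fun s => (γ s).1) s = a') (hb' : deriv (deriv fun s => (γ s).2) s = b')
    (ha0 : 0 < a) (hb0 : 0 < b) (hv : 0 < v)
    (hv2 : 2 * nullComp M ((γ s).1 * (γ s).2) * (a * b) = v ^ 2)
    (heq : 1 / v * (a * b' - b * a' + a * b * (nullCompDeriv M ((γ s).1 * (γ s).2) /
        nullComp M ((γ s).1 * (γ s).2)) * ((γ s).1 * b - (γ s).2 * a)) / (2 * a * b) -
      2 * areaRadiusDeriv M ((γ s).1 * (γ s).2) * (a * (γ s).2 - b * (γ s).1) /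
        (v * areaRadius M ((γ s).1 * (γ s).2)) = 3 * H) :
    IsSpacelikeWithMeanCurvature (metric M) dT (rotate γ) ![s, θ, φ] H := by
  have hsin := Real.sin_pos_of_pos_of_lt_pi hθ.1 hθ.2
  have hr := areaRadius_pos hM hw
  have he := nullComp_pos hM hw
  obtain ⟨c1, c2⟩ := covTangent_rotate_zero hM γ φ hw hsin.ne'
  obtain ⟨c3, c4⟩ := covTangent_rotate_one hM γ φ hw hsin.ne'
  obtain ⟨c5, c6⟩ := covTangent_rotate_two hM γ φ hw hsin.ne'
  rw [ha', ha] at c1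
  rw [hb', hb] at c2
  have hF := firstForm_rotate M γ s θ φ
  rw [ha, hb] at hF
  have hx : ∀ f : ℝ → ℝ, f (rotate γ ![s, θ, φ] 0 * rotate γ ![s, θ, φ] 1) =
    f ((γ s).1 * (γ s).2) := fun _ => rfl
  have hx2 : rotate γ ![s, θ, φ] 2 = θ := rfl
  refine ⟨?_, ![-a / v, b / v, 0, 0], ?_, ?_, ?_, ?_⟩
  · rw [hF, Matrix.posDef_diagonal_iff]
    intro i
    fin_cases i <;> simp <;> positivity
  · intro i
    fin_cases i
    · simp [scalar_metric, tangent_rotate_zero, ha, hb]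
      ring_nf; simp
    · simp [scalar_metric, tangent_rotate_one]
    · simp [scalar_metric, tangent_rotate_two]
  · simp only [scalar_metric, hx]
    simp
    field_simp
    linarith
  · simp only [scalar_metric, hx, dT]
    simp
    have : 0 < a / v + b / v := by positivity
    exact mul_neg_of_pos_of_neg he (by rw [neg_div]; linarith)
  · have hdiag : ∀ d : Fin 3 → ℝ, (∀ i, d i ≠ 0) →
        (Matrix.diagonal d)⁻¹ = Matrix.diagonal fun i => (d i)⁻¹ := fun d hd => by
      refine Matrix.inv_eq_right_inv ?_
      rw [Matrix.diagonal_mul_diagonal, ← Matrix.diagonal_one]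
      congr 1; funext i; exact mul_inv_cancel₀ (hd i)
    rw [hF, hdiag, Matrix.trace]
    · simp only [Matrix.diag_apply, Matrix.diagonal_mul, Fin.sum_univ_three, secondForm,
        Matrix.of_apply, scalar_metric, hx, hx2]
      simp [c1, c2, c3, c4, c5, c6]
      have hH : H = 3⁻¹ * (3 * H) := by ring
      rw [hH, ← heq]
      field_simp
      ring
    · intro i
      fin_cases i <;> simp [he.ne', ha0.ne', hb0.ne', hr.ne', hsin.ne']

/-! ### The leaves have constant mean curvature -/

/-- The algebraic identity behind the mean curvature equation: the logarithmic derivatives of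
the null coordinates `U`, `V` along the curve are `-α` and `β`, and `κ` is that of `μ r / (2M - r)`,
while `E` stands for `exp(r / 2M)`. -/
theorem meanCurvature_identity {M r m E μ L Y L' Y' U V α β α' β' a b a' b' κ H : ℝ}
    (hM : 0 < M) (hr : 0 < r) (hm0 : 0 < m) (hm : 2 * M - r = m) (hE : 0 < E) (hμ : 0 < μ)
    (hLY1 : 0 < L + Y) (hLY2 : 0 < L - Y) (hU : 0 < -U) (hV : 0 < V)
    (hUV : U * V = -(m * E)) (hLY : L ^ 2 - Y ^ 2 = r ^ 3 * m)
    (hα : μ * r * (L + Y) / (4 * M * m) = α) (hβ : μ * r * (L - Y) / (4 * M * m) = β)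
    (ha : -U * α = a) (hb : V * β = b)
    (hα' : α' = α * (κ + (L' + Y') / (L + Y))) (hβ' : β' = β * (κ + (L' - Y') / (L - Y)))
    (ha' : -a * α + -U * α' = a') (hb' : b * β + V * β' = b')
    (hL' : -H * (3 * r ^ 2 * (μ * Y)) = L')
    (hY' : Y' = μ * (-(6 * H * r ^ 2 * L) - 6 * M * r ^ 2 + 4 * r ^ 3) / 2) :
    1 / (μ * r ^ 2) * (a * b' - b * a' + a * b * -((1 / (2 * M) + 1 / r) * (2 * M * E⁻¹ / r)) *
        (U * b - V * a)) / (2 * a * b) -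
      2 * (2 * M * E⁻¹ / r) * (a * V - b * U) / (μ * r ^ 2 * r) = 3 * H := by
  have hα0 : 0 < α := by rw [← hα]; positivity
  have hβ0 : 0 < β := by rw [← hβ]; positivity
  have ha0 : 0 < a := by rw [← ha]; positivity
  have hb0 : 0 < b := by rw [← hb]; positivity
  have hsum : α + β = μ * r * L / (2 * M * m) := by
    rw [← hα, ← hβ]; field_simp; ring
  -- the common factor of `L + Y` and `L - Y` in `α` and `β` cancels
  have h1 : (L' - Y') / (L - Y) - (L' + Y') / (L + Y) =
      μ * (6 * H * r ^ 2 + 2 * L * (3 * M - 2 * r) / (r * m)) := by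
    have h2 : (L' - Y') / (L - Y) - (L' + Y') / (L + Y) =
        2 * (L' * Y - Y' * L) / (L ^ 2 - Y ^ 2) := by
      rw [show L ^ 2 - Y ^ 2 = (L - Y) * (L + Y) by ring]
      field_simp; ring
    have h3 : L' * Y - Y' * L =
        μ * (3 * H * r ^ 2 * (L ^ 2 - Y ^ 2) + L * (3 * M * r ^ 2 - 2 * r ^ 3)) := by
      rw [← hL', hY']; ring
    rw [h2, h3, hLY]
    field_simp
    ring
  have h4 : a * b' - b * a' =
      a * b * (α + β + ((L' - Y') / (L - Y) - (L' + Y') / (L + Y))) := by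
    rw [← ha', ← hb', hα', hβ', ← ha, ← hb]; ring
  have h5 : U * b - V * a = -(m * E) * (α + β) := by rw [← hUV, ← ha, ← hb]; ring
  have h6 : a * V - b * U = m * E * (α + β) := by
    rw [← neg_neg (m * E), ← hUV, ← ha, ← hb]; ring
  rw [h4, h1, h5, h6, hsum]
  subst hm
  field_simp
  ring

/-- The system of differential equations `r' = μ Y`, `Y' = μ D'(r) / 2` with `Y² = D(r)`, together
with `t' = μ r L / (2M - r)`, `L = -H r³ - c`, written in null coordinates, describes hypersurfaces
of constant mean curvature `H`. -/
theorem isSpacelikeWithMeanCurvature_of_ode {M H c : ℝ} (hM : 0 < M) {γ : ℝ → ℝ × ℝ}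
    {r Y μ : ℝ → ℝ} {I : Set ℝ} (hI : IsOpen I) (hr : ∀ s ∈ I, r s ∈ Ioo 0 (2 * M))
    (hUV : ∀ s ∈ I, (γ s).1 * (γ s).2 = radiusProd M (r s))
    (hV0 : ∀ s ∈ I, 0 < (γ s).2)
    (hμ0 : ∀ s ∈ I, 0 < μ s)
    (hL : ∀ s ∈ I, 0 < -H * r s ^ 3 - c) (hY2 : ∀ s ∈ I, Y s ^ 2 = disc M H c (r s))
    (hU' : ∀ s ∈ I, HasDerivAt (fun s => (γ s).1)
      (-(γ s).1 * (μ s * r s * (-H * r s ^ 3 - c + Y s) / (4 * M * (2 * M - r s)))) s)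
    (hV' : ∀ s ∈ I, HasDerivAt (fun s => (γ s).2)
      ((γ s).2 * (μ s * r s * (-H * r s ^ 3 - c - Y s) / (4 * M * (2 * M - r s)))) s)
    (hr' : ∀ s ∈ I, HasDerivAt r (μ s * Y s) s)
    (hY' : ∀ s ∈ I, HasDerivAt Y (μ s * (6 * H * r s ^ 2 * (H * r s ^ 3 + c) -
      6 * M * r s ^ 2 + 4 * r s ^ 3) / 2) s)
    (hμ' : ∀ s ∈ I, DifferentiableAt ℝ μ s) {s θ : ℝ} (φ : ℝ) (hs : s ∈ I)
    (hθ : θ ∈ Ioo 0 Real.pi) :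
    IsSpacelikeWithMeanCurvature (metric M) dT (rotate γ) ![s, θ, φ] H := by
  have hr0 := (hr s hs).1
  have hm : 0 < 2 * M - r s := sub_pos.2 (hr s hs).2
  have hμ := hμ0 s hs
  have hw : -2 * M < (γ s).1 * (γ s).2 := by
    rw [hUV s hs]; exact neg_two_mul_lt_radiusProd hM hr0
  have hrad : areaRadius M ((γ s).1 * (γ s).2) = r s := by
    rw [hUV s hs, areaRadius_radiusProd hM hr0]
  -- `hA` and `hB` differentiate the formulas for `U'` and `V'` once more
  set L : ℝ → ℝ := fun s => -H * r s ^ 3 - c with hLdef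
  have hL' : HasDerivAt L (-H * (3 * r s ^ 2 * (μ s * Y s))) s := by
    exact ((((hr' s hs).fun_pow 3).const_mul (-H)).sub_const c).congr_deriv (by norm_num)
  have hm' : HasDerivAt (fun s => 4 * M * (2 * M - r s)) (4 * M * -(μ s * Y s)) s :=
    ((hr' s hs).const_sub (2 * M)).const_mul (4 * M)
  have hμr := (hμ' s hs).hasDerivAt.fun_mul (hr' s hs)
  have hm0 : 4 * M * (2 * M - r s) ≠ 0 := by positivity
  have hA := (hU' s hs).fun_neg.fun_mul ((hμr.fun_mul (hL'.fun_add (hY' s hs))).fun_div hm' hm0)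
  have hB := (hV' s hs).fun_mul ((hμr.fun_mul (hL'.fun_sub (hY' s hs))).fun_div hm' hm0)
  have hdU : deriv (fun s => (γ s).1) =ᶠ[𝓝 s] fun s =>
      -(γ s).1 * (μ s * r s * (L s + Y s) / (4 * M * (2 * M - r s))) := by
    filter_upwards [hI.mem_nhds hs] with x hx using (hU' x hx).deriv
  have hdV : deriv (fun s => (γ s).2) =ᶠ[𝓝 s] fun s =>
      (γ s).2 * (μ s * r s * (L s - Y s) / (4 * M * (2 * M - r s))) := by
    filter_upwards [hI.mem_nhds hs] with x hx using (hV' x hx).deriv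
  have hY2s := hY2 s hs
  have hLs : 0 < L s := hL s hs
  have hLY : L s ^ 2 - Y s ^ 2 = r s ^ 3 * (2 * M - r s) := by
    rw [hY2s, disc, hLdef]; ring
  have hlt : |Y s| < L s := by
    refine abs_lt_of_sq_lt_sq ?_ hLs.le
    have : 0 < r s ^ 3 * (2 * M - r s) := by positivity
    linarith
  have hLY1 : 0 < L s + Y s := by linarith [neg_abs_le (Y s)]
  have hLY2 : 0 < L s - Y s := by linarith [le_abs_self (Y s)]
  have hV := hV0 s hs
  have hUVs : (γ s).1 * (γ s).2 = -((2 * M - r s) * Real.exp (r s / (2 * M))) := by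
    rw [hUV s hs, radiusProd]; ring
  have hU : 0 < -(γ s).1 := by
    have h1 : 0 < (2 * M - r s) * Real.exp (r s / (2 * M)) := by positivity
    exact pos_of_mul_pos_left (by linarith : 0 < -(γ s).1 * (γ s).2) hV.le
  refine isSpacelikeWithMeanCurvature_rotate (v := μ s * r s ^ 2) hM γ φ hw hθ hdU.self_of_nhds
    hdV.self_of_nhds (hdU.deriv_eq.trans hA.deriv) (hdV.deriv_eq.trans hB.deriv)
    (by positivity) (by positivity) (by positivity) ?_ ?_
  · beta_reduce
    rw [nullComp, hrad, neg_div, Real.exp_neg]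
    have hE : 0 < Real.exp (r s / (2 * M)) := Real.exp_pos _
    generalize Real.exp (r s / (2 * M)) = E at *
    generalize (γ s).1 = U at *
    generalize (γ s).2 = V at *
    calc 2 * (8 * M ^ 2 * E⁻¹ / r s) * (-U * (μ s * r s * (L s + Y s) / (4 * M * (2 * M - r s))) *
          (V * (μ s * r s * (L s - Y s) / (4 * M * (2 * M - r s)))))
        = 1 / (E * r s) * -(U * V) * (μ s * r s) ^ 2 * (L s ^ 2 - Y s ^ 2) /
          (2 * M - r s) ^ 2 := by field_simp; ring
      _ = (μ s * r s ^ 2) ^ 2 := by rw [hUVs, hLY]; field_simp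
  · beta_reduce
    rw [nullCompDeriv, areaRadiusDeriv, hrad, neg_div (2 * M), Real.exp_neg,
      show ∀ x, -x * (1 / (2 * M) + 1 / r s) *
        (2 * M * (Real.exp (r s / (2 * M)))⁻¹ / r s) / x = x / x * -((1 / (2 * M) + 1 / r s) *
        (2 * M * (Real.exp (r s / (2 * M)))⁻¹ / r s)) from fun x => by ring,
      div_self (nullComp_pos hM hw).ne', one_mul]
    refine meanCurvature_identity (Y' := μ s * (6 * H * r s ^ 2 * (H * r s ^ 3 + c) -
      6 * M * r s ^ 2 + 4 * r s ^ 3) / 2)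
      (κ := deriv μ s / μ s + μ s * Y s / r s + μ s * Y s / (2 * M - r s))
      hM hr0 hm rfl (Real.exp_pos _) hμ hLY1 hLY2 hU hV hUVs hLY rfl rfl rfl rfl ?_ ?_ rfl rfl
      rfl ?_
    · generalize 2 * M - r s = m at hm ⊢
      generalize L s + Y s = p at hLY1 ⊢
      field_simp
      ring
    · generalize 2 * M - r s = m at hm ⊢
      generalize L s - Y s = p at hLY2 ⊢
      field_simp
      ring
    · simp only [hLdef]; ring

/-- The equation `t' = μ r L / (2M - r)` for `μ = 2 / √(R E)`, where `E` is the quotient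
`discQuot`. -/
theorem speed_eq_mul {M H R : ℝ} (hM : 0 < M) (hR : R ∈ Ioo 0 (rMin M H)) (σ : ℝ) :
    speed M H (R, σ) = 2 / (√R * √(discQuot M H R (1 - σ ^ 2))) * (R * (1 - σ ^ 2)) *
      (-H * (R * (1 - σ ^ 2)) ^ 3 - k M H R) / (2 * M - R * (1 - σ ^ 2)) := by
  have hR0 := hR.1
  have h1 := Real.sqrt_pos.2 hR0
  have h2 := Real.sqrt_pos.2 (discQuot_pos hM (Ioo_subset_Ico_self hR)
    (y := 1 - σ ^ 2) (by linarith [sq_nonneg σ]))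
  have h3 := mul_one_sub_sq_lt hM (Ioo_subset_Ico_self hR) σ
  rw [neg_mul_sub_k hR0.le, speed]
  field_simp

/-- The leaf solves the system with `Y = -R^{3/2} σ √E` and `μ = 2 / √(R E)`, where `E` is the
quotient `discQuot`. -/
theorem isSpacelikeWithMeanCurvature_param {M H R σ θ : ℝ} (hM : 0 < M)
    (hR : R ∈ Ioo 0 (rMin M H)) (hσ : σ ∈ Ioo (-1) 1) (hθ : θ ∈ Ioo 0 Real.pi) (φ : ℝ) :
    IsSpacelikeWithMeanCurvature (metric M) dT (rotate fun σ => param M H (R, σ)) ![σ, θ, φ]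
      H := by
  have hR0 := hR.1
  have hR' := mem_Ioo_two_mul hM hR
  have hsR := Real.sqrt_pos.2 hR0
  have hsR2 := Real.sq_sqrt hR0.le
  have hE : ∀ s : ℝ, 0 < discQuot M H R (1 - s ^ 2) := fun s =>
    discQuot_pos hM (Ioo_subset_Ico_self hR) (by linarith [sq_nonneg s])
  have hsE : ∀ s : ℝ, 0 < √(discQuot M H R (1 - s ^ 2)) := fun s => Real.sqrt_pos.2 (hE s)
  have hrad : ∀ s : ℝ, HasDerivAt (fun s : ℝ => R * (1 - s ^ 2)) (R * -(2 * s)) s := fun s => by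
    simpa using ((hasDerivAt_pow 2 s).const_sub 1).const_mul R
  have hEd : ∀ s : ℝ, ∃ d, HasDerivAt (discQuot M H R) d (1 - s ^ 2) := fun s => by
    have : DifferentiableAt ℝ (discQuot M H R) (1 - s ^ 2) := by unfold discQuot; fun_prop
    exact ⟨_, this.hasDerivAt⟩
  have hsub : ∀ s : ℝ, HasDerivAt (fun s : ℝ => 1 - s ^ 2) (-(2 * s)) s := fun s => by
    simpa using (hasDerivAt_pow 2 s).const_sub 1
  have htor : ∀ s ∈ Ioo (-1 : ℝ) 1, HasDerivAt (fun s => tortoise M (R * (1 - s ^ 2)))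
      (R * (1 - s ^ 2) / (R * (1 - s ^ 2) - 2 * M) * (R * -(2 * s))) s := fun s hs =>
    HasDerivAt.comp (h₂ := tortoise M) s
      (hasDerivAt_tortoise (one_sub_sq_mem' hM hR hs).2.ne) (hrad s)
  refine isSpacelikeWithMeanCurvature_of_ode (c := k M H R) (r := fun s => R * (1 - s ^ 2))
    (Y := fun s => -(R * √R * s * √(discQuot M H R (1 - s ^ 2))))
    (μ := fun s => 2 / (√R * √(discQuot M H R (1 - s ^ 2)))) hM isOpen_Ioo
    (fun s hs => one_sub_sq_mem' hM hR hs)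
    (fun s hs => coordU_mul_coordV hM (one_sub_sq_mem' hM hR hs))
    (fun s hs => coordV_pos _ _ _) (fun s hs => ?_) (fun s hs => ?_) (fun s hs => ?_)
    (fun s hs => ?_) (fun s hs => ?_) (fun s hs => ?_) (fun s hs => ?_) (fun s hs => ?_) φ hσ hθ
  · have := hsE s
    positivity
  · have hr := one_sub_sq_mem hR0 hs
    rcases hr.2.eq_or_lt with h | h
    · have := qFun_pos hR'
      rw [h, k_eq H hR0.le]
      linarith
    · exact (qFun_pos (one_sub_sq_mem' hM hR hs)).trans (qFun_lt hM hR ⟨hr.1, h⟩)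
  · rw [disc_mul H hR0.le hR'.2.le, neg_sq, mul_pow, mul_pow, mul_pow, hsR2,
      Real.sq_sqrt (hE s).le]
    ring
  · have h1 := ((((hasDerivAt_time hM hR s).fun_sub (htor s hs)).fun_neg.div_const
      (4 * M)).exp).fun_neg
    refine h1.congr_deriv ?_
    rw [speed_eq_mul hM hR s]
    have h2 := hsE s
    have h3 := sub_pos.2 (one_sub_sq_mem' hM hR hs).2
    simp only [param, coordU_eq]
    rw [show R * (1 - s ^ 2) / (R * (1 - s ^ 2) - 2 * M) * (R * -(2 * s)) =
      R * (1 - s ^ 2) * (R * (2 * s)) / (2 * M - R * (1 - s ^ 2)) by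
        rw [← neg_sub (2 * M), div_neg]; ring]
    generalize √(discQuot M H R (1 - s ^ 2)) = E at *
    generalize Real.exp _ = u
    generalize 2 * M - R * (1 - s ^ 2) = m at *
    generalize -H * (R * (1 - s ^ 2)) ^ 3 - k M H R = L at *
    field_simp
    ring
  · have h1 := ((((hasDerivAt_time hM hR s).fun_add (htor s hs)).div_const (4 * M)).exp)
    refine h1.congr_deriv ?_
    rw [speed_eq_mul hM hR s]
    have h2 := hsE s
    have h3 := sub_pos.2 (one_sub_sq_mem' hM hR hs).2
    simp only [param, coordV_eq]
    rw [show R * (1 - s ^ 2) / (R * (1 - s ^ 2) - 2 * M) * (R * -(2 * s)) =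
      R * (1 - s ^ 2) * (R * (2 * s)) / (2 * M - R * (1 - s ^ 2)) by
        rw [← neg_sub (2 * M), div_neg]; ring]
    generalize √(discQuot M H R (1 - s ^ 2)) = E at *
    generalize Real.exp _ = u
    generalize 2 * M - R * (1 - s ^ 2) = m at *
    generalize -H * (R * (1 - s ^ 2)) ^ 3 - k M H R = L at *
    field_simp
    ring
  · refine (hrad s).congr_deriv ?_
    have := hsE s
    field_simp
  · obtain ⟨d, hd⟩ := hEd s
    have h1 : HasDerivAt (fun s => discQuot M H R (1 - s ^ 2)) (d * -(2 * s)) s :=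
      HasDerivAt.comp (h₂ := discQuot M H R) s hd (hsub s)
    have h2 := (((hasDerivAt_id s).const_mul (R * √R)).fun_mul (h1.sqrt (hE s).ne')).fun_neg
    refine h2.congr_deriv ?_
    -- differentiate `D(R y) = R³ (1 - y) E(y)`
    have h3 : HasDerivAt (fun y => disc M H (k M H R) (R * y)) _ (1 - s ^ 2) :=
      hasDerivAt_comp_mul_right (hasDerivAt_disc M H (k M H R) (R * (1 - s ^ 2)))
    have h4 : HasDerivAt (fun y => R ^ 3 * (1 - y) * discQuot M H R y)
        (R ^ 3 * -1 * discQuot M H R (1 - s ^ 2) + R ^ 3 * (1 - (1 - s ^ 2)) * d) (1 - s ^ 2) :=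
      (((hasDerivAt_id (1 - s ^ 2)).const_sub 1).const_mul (R ^ 3)).fun_mul hd
    simp only [disc_mul H hR0.le hR'.2.le] at h3
    have h5 := h3.unique h4
    have h6 := hsE s
    have h7 := Real.sq_sqrt (hE s).le
    rw [← h7] at h5
    simp only [id]
    generalize √(discQuot M H R (1 - s ^ 2)) = E at *
    generalize 6 * H * (R * (1 - s ^ 2)) ^ 2 * (H * (R * (1 - s ^ 2)) ^ 3 + k M H R) -
      6 * M * (R * (1 - s ^ 2)) ^ 2 + 4 * (R * (1 - s ^ 2)) ^ 3 = D' at *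
    have h8 : D' = R ^ 2 * (-E ^ 2 + s ^ 2 * d) := by
      refine mul_right_cancel₀ hR0.ne' ?_
      linear_combination h5
    rw [h8]
    field_simp
    rw [hsR2]
    ring
  · have h1 : DifferentiableAt ℝ (fun s => √(discQuot M H R (1 - s ^ 2))) s := by
      refine DifferentiableAt.sqrt ?_ (hE s).ne'
      unfold discQuot; fun_prop
    exact (differentiableAt_const 2).fun_div (h1.const_mul (√R)) (mul_pos hsR (hsE s)).ne'

theorem isTSSCMC_leaf {M H c : ℝ} (hM : 0 < M) (hc : c ∈ Ioo (cMin M H) 0) :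
    IsTSSCMC M H (leaf M H c) := by
  have hR := rMinus_mem hM hc
  rw [← k_rMinus hM hc, leaf_eq_image hM hR]
  generalize rMinus M H c = R at *
  refine ⟨⟨?_, -1, 1, fun σ => param M H (R, σ), by norm_num, ?_, rfl, ?_⟩, ?_⟩
  · rintro _ ⟨σ, hσ, rfl⟩
    exact (coord_mem_regionII hM (one_sub_sq_mem' hM hR hσ)).1
  · exact (contDiffOn_param hM H).comp (f := fun σ : ℝ => (R, σ)) (by fun_prop)
      fun σ hσ => ⟨hR, hσ⟩
  · exact fun σ hσ θ hθ φ => isSpacelikeWithMeanCurvature_param hM hR hσ hθ φ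
  · rintro _ ⟨σ, hσ, rfl⟩
    refine ⟨-σ, ⟨by linarith [hσ.2], by linarith [hσ.1]⟩, ?_⟩
    simp only [param, time_neg, neg_sq]
    rw [coord_neg.1, coord_neg.2]

end Kruskal


theorem mainTheorem2 (M : ℝ) (hM : 0 < M) (H : ℝ) :
    (∀ c ∈ Ioo (Kruskal.cMin M H) 0, Kruskal.IsTSSCMC M H (Kruskal.leaf M H c)) ∧
    Kruskal.IsFoliation (Kruskal.innerRegion M H) (Ioo (Kruskal.cMin M H) 0)
      (Kruskal.leaf M H) ∧
    (∀ c ∈ Ioo (Kruskal.cMin M H) 0,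
      IntervalIntegrable (Kruskal.slope M H c) MeasureTheory.volume 0 (Kruskal.rMinus M H c)) ∧
    (∀ c ∈ Ioo (Kruskal.cMin M H) 0, ∃ d ≤ (0 : ℝ),
      HasDerivAt (fun c' => Real.log (Kruskal.coordV M (Kruskal.height M H c' 0) 0)) d c) ∧
    Tendsto (fun c => Kruskal.height M H c 0) (𝓝[>] (Kruskal.cMin M H)) atTop ∧
    Tendsto (fun c => Kruskal.height M H c 0) (𝓝[<] 0) (𝓝 0) ∧
    (∀ t : ℝ, ∃ ρ : ℝ → ℝ,
      (∀ᶠ c in 𝓝[>] (Kruskal.cMin M H), ρ c ∈ Ioo 0 (2 * M) ∧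
        ∀ r ∈ Ioo 0 (2 * M),
          (Kruskal.coordU M t r, Kruskal.coordV M t r) ∈ Kruskal.leaf M H c ↔ r = ρ c) ∧
      Tendsto ρ (𝓝[>] (Kruskal.cMin M H)) (𝓝 (Kruskal.rMin M H))) := by
  refine ⟨fun c hc => Kruskal.isTSSCMC_leaf hM hc, Kruskal.isFoliation_leaf hM H, fun c hc => ?_,
    fun c hc => Kruskal.exists_hasDerivAt_log_coordV hM hc, Kruskal.tendsto_height_cMin hM H,
    Kruskal.tendsto_height_zero hM H, Kruskal.exists_tendsto_radius hM H⟩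
  have hR := Kruskal.rMinus_mem hM hc
  have h1 := Kruskal.intervalIntegrable_slope hM hR ⟨le_rfl, hR.1.le⟩
  rwa [Kruskal.k_rMinus hM hc] at h1
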